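/- Let $M$ be a connected, Hausdorff, paracompact, smooth $4$-dimensional manifold. Let $\mathcal B_{\mathrm{Riem}}\to M$ be the bundle of tensors $R_{abc}{}^{d}$ with the index symmetries of the Riemann tensor of a metric ($R_{(ab)c}{}^{d}=0$, $R_{[abc]}{}^{d}=0$, $R_{abn}{}^{n}=0$), let $J^n\mathcal B_{\mathrm{Riem}}$ be the bundle of $n$-jets of its smooth cross-sections, and let $\mathcal B_{0,2}\to M$ be the bundle of all tensors $S_{ab}$ with two covariant indices. Every diffeomorphism $\varphi$ of $M$ acts on each of these bundle spaces by transport of tensors (and of cross-sections). For $n\ge 0$, let $\chi: J^n\mathcal B_{\mathrm{Riem}}\to\mathcal B_{0,2}$ be a concomitant of the Riemann tensor, i.e. a smooth mapping that commutes with the actions of all diffeomorphisms of $M$. Then the following are equivalent. (1) $\chi$ is homogeneous of weight $0$ under constant rescaling of the metric: for every smooth Lorentz metric $g_{ab}$ of signature $(+,-,-,-)$ on an open set $U\subseteq M$, every constant $\xi>0$ and every $p\in U$, the value of $\chi$ on the $n$-jet at $p$ of the Riemann tensor $R_{abc}{}^{d}$ of $\xi g_{ab}$ is $\xi^{0}$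 times its value on the $n$-jet at $p$ of the Riemann tensor of $g_{ab}$. (2) $\chi$ is a zeroth-order concomitant of the Riemann tensor: $\chi=\chi_0\circ\theta$, where $\theta:J^n\mathcal B_{\mathrm{Riem}}\to\mathcal B_{\mathrm{Riem}}$ sends the $n$-jet of a cross-section at $p$ to its value at $p$, and $\chi_0:\mathcal B_{\mathrm{Riem}}\to\mathcal B_{0,2}$ is a smooth mapping that commutes with the actions of all diffeomorphisms of $M$. -/

import Mathlib

open scoped Manifold ContDiff Topology

noncomputable section

namespace Concom

/-- The model space of a four-dimensional manifold. -/
abbrev E4 : Type := EuclideanSpace ℝ (Fin 4)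

/-- The `i`-th standard basis vector of the model space. -/
abbrev stdVec (i : Fin 4) : E4 := EuclideanSpace.single i (1 : ℝ)

/-! ### Tensors on a vector space -/

/-- Tensors `R_{abc}^d` on `V`, written as `R u v w`, with the linear index symmetries of the
Riemann tensor of a metric: `R_{(ab)c}^d = 0`, `R_{[abc]}^d = 0` and `R_{abn}^n = 0`. -/
def curvatureTensors (V : Type*) [AddCommGroup V] [Module ℝ V] :
    Submodule ℝ (V →ₗ[ℝ] V →ₗ[ℝ] V →ₗ[ℝ] V) where
  carrier := {R | (∀ u v w, R u v w = -R v u w) ∧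
    (∀ u v w, R u v w + R v w u + R w u v = 0) ∧
    ∀ u v, LinearMap.trace ℝ V (R u v) = 0}
  add_mem' := by
    rintro R S ⟨h1, h2, h3⟩ ⟨k1, k2, k3⟩
    refine ⟨fun u v w => ?_, fun u v w => ?_, fun u v => ?_⟩
    · simp only [LinearMap.add_apply]
      rw [h1 u v w, k1 u v w]; abel
    · simp only [LinearMap.add_apply]
      rw [show ∀ a b c d e f : V, (a + b) + (c + d) + (e + f) = (a + c + e) + (b + d + f) by
        intros; abel, h2, k2, add_zero]
    · simp only [LinearMap.add_apply, map_add, h3, k3, add_zero]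
  zero_mem' := by simp
  smul_mem' := by
    rintro c R ⟨h1, h2, h3⟩
    refine ⟨fun u v w => ?_, fun u v w => ?_, fun u v => ?_⟩
    · simp only [LinearMap.smul_apply]
      rw [h1 u v w, smul_neg]
    · simp only [LinearMap.smul_apply]
      rw [← smul_add, ← smul_add, h2, smul_zero]
    · simp only [LinearMap.smul_apply, map_smul, h3, smul_zero]

section Transport

variable {V W : Type*} [AddCommGroup V] [Module ℝ V] [AddCommGroup W] [Module ℝ W]

/-- Transport of tensors with three covariant indices and one contravariant index. -/
def triTransport (A : V ≃ₗ[ℝ] W) :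
    (V →ₗ[ℝ] V →ₗ[ℝ] V →ₗ[ℝ] V) ≃ₗ[ℝ] (W →ₗ[ℝ] W →ₗ[ℝ] W →ₗ[ℝ] W) :=
  A.arrowCongr (A.arrowCongr (A.arrowCongr A))

theorem triTransport_apply (A : V ≃ₗ[ℝ] W) (R : V →ₗ[ℝ] V →ₗ[ℝ] V →ₗ[ℝ] V) (u v w : W) :
    triTransport A R u v w = A (R (A.symm u) (A.symm v) (A.symm w)) := rfl

theorem triTransport_mem (A : V ≃ₗ[ℝ] W) {R : V →ₗ[ℝ] V →ₗ[ℝ] V →ₗ[ℝ] V}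
    (hR : R ∈ curvatureTensors V) : triTransport A R ∈ curvatureTensors W := by
  obtain ⟨h1, h2, h3⟩ := hR
  refine ⟨fun u v w => ?_, fun u v w => ?_, fun u v => ?_⟩
  · rw [triTransport_apply, triTransport_apply, h1, map_neg]
  · rw [triTransport_apply, triTransport_apply, triTransport_apply, ← map_add, ← map_add, h2,
      map_zero]
  · have : triTransport A R u v = A.conj (R (A.symm u) (A.symm v)) := rfl
    rw [this, LinearMap.trace_conj', h3]

/-- Transport of curvature-type tensors along a linear isomorphism. -/
def curvTransport (A : V ≃ₗ[ℝ] W) (R : curvatureTensors V) : curvatureTensors W :=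
  ⟨triTransport A R.1, triTransport_mem A R.2⟩

/-- Transport of tensors with two covariant indices along a linear isomorphism. -/
def covTransport (A : V ≃ₗ[ℝ] W) (S : V →ₗ[ℝ] V →ₗ[ℝ] ℝ) : W →ₗ[ℝ] W →ₗ[ℝ] ℝ :=
  A.arrowCongr (A.arrowCongr (LinearEquiv.refl ℝ ℝ)) S

/-- Lorentz signature `(+,-,-,-)`: there is a basis in which `g` is `diag(1,-1,-1,-1)`. -/
def IsLorentz (g : V →ₗ[ℝ] V →ₗ[ℝ] ℝ) : Prop :=
  ∃ b : Module.Basis (Fin 4) ℝ V, ∀ i j, g (b i) (b j) =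
    if i = j then (if i = 0 then 1 else -1) else 0

end Transport

section Manifold

variable {M : Type*} [TopologicalSpace M] [ChartedSpace E4 M]

/-- The tangent space of `M` at `p`. -/
abbrev Tan (p : M) : Type := TangentSpace 𝓘(ℝ, E4) p

/-- Tensors of type `R_{abc}^d` at `p`. -/
abbrev Tri (p : M) : Type := Tan p →ₗ[ℝ] Tan p →ₗ[ℝ] Tan p →ₗ[ℝ] Tan p

/-- Tensors with two covariant indices at `p`. -/
abbrev Cov (p : M) : Type := Tan p →ₗ[ℝ] Tan p →ₗ[ℝ] ℝ

/-- Curvature-type tensors at `p`. -/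
abbrev Curv (p : M) : Type := curvatureTensors (Tan p)

/-- The group of diffeomorphisms of `M`. -/
abbrev Diff (M : Type*) [TopologicalSpace M] [ChartedSpace E4 M] : Type _ :=
  Diffeomorph 𝓘(ℝ, E4) 𝓘(ℝ, E4) M M ∞

/-- The charts of the (maximal) smooth atlas. -/
abbrev Charts (M : Type*) [TopologicalSpace M] [ChartedSpace E4 M] :
    Set (OpenPartialHomeomorph M E4) :=
  IsManifold.maximalAtlas 𝓘(ℝ, E4) ∞ M

/-! ### Components in a chart -/

/-- The coordinate vector `∂/∂xⁱ` of the chart `e` at `q`. -/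
def coordVec (e : OpenPartialHomeomorph M E4) (q : M) (i : Fin 4) : Tan q :=
  (mfderiv 𝓘(ℝ, E4) 𝓘(ℝ, E4) e.symm (e q) (stdVec i) : E4)

/-- The coordinate covector `dxⁱ` of the chart `e` at `q`. -/
def coordCov (e : OpenPartialHomeomorph M E4) (q : M) (i : Fin 4) : Tan q →ₗ[ℝ] ℝ :=
  (EuclideanSpace.proj (𝕜 := ℝ) i : E4 →L[ℝ] ℝ).toLinearMap.comp
    (mfderiv 𝓘(ℝ, E4) 𝓘(ℝ, E4) e q).toLinearMap

/-- Arrays of components `R_{ijk}^l`. -/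
abbrev TriArr : Type := Fin 4 → Fin 4 → Fin 4 → Fin 4 → ℝ

/-- Arrays of components `S_{ij}`. -/
abbrev CovArr : Type := Fin 4 → Fin 4 → ℝ

/-- The components `R_{ijk}^l` of a tensor at `q` in the chart `e`. -/
def triComp (e : OpenPartialHomeomorph M E4) (q : M) (R : Tri q) : TriArr :=
  fun i j k l => coordCov e q l (R (coordVec e q i) (coordVec e q j) (coordVec e q k))

/-- The components `S_{ij}` of a tensor at `q` in the chart `e`. -/
def covComp (e : OpenPartialHomeomorph M E4) (q : M) (S : Cov q) : CovArr :=
  fun i j => S (coordVec e q i) (coordVec e q j)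

/-- The component functions of a field of curvature-type tensors in the chart `e`, as functions of
the coordinates. -/
def curvFieldComp (e : OpenPartialHomeomorph M E4) (R : ∀ q : M, Curv q) (x : E4) : TriArr :=
  triComp e (e.symm x) (R (e.symm x)).1

/-- The component functions of a field of two-covariant tensors in the chart `e`. -/
def covFieldComp (e : OpenPartialHomeomorph M E4) (S : ∀ q : M, Cov q) (x : E4) : CovArr :=
  covComp e (e.symm x) (S (e.symm x))

/-! ### The bundles and their inductions -/

variable (M) in
/-- The bundle space of curvature-type tensors (values of Riemann tensors). -/
abbrev BRiem : Type _ := Σ p : M, Curv p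

variable (M) in
/-- The bundle space of tensors with two covariant indices. -/
abbrev BCov : Type _ := Σ p : M, Cov p

/-- The differential of a diffeomorphism as a linear isomorphism of tangent spaces. -/
def diffEquiv (φ : Diff M) (p : M) : Tan p ≃ₗ[ℝ] Tan (φ p) :=
  (φ.mfderivToContinuousLinearEquiv (x := p) (by simp)).toLinearEquiv

/-- The action of a diffeomorphism on the bundle of curvature-type tensors. -/
def riemInduction (φ : Diff M) (u : BRiem M) : BRiem M :=
  ⟨φ u.1, curvTransport (diffEquiv φ u.1) u.2⟩

/-- The action of a diffeomorphism on the bundle of two-covariant tensors. -/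
def covInduction (φ : Diff M) (u : BCov M) : BCov M :=
  ⟨φ u.1, covTransport (diffEquiv φ u.1) u.2⟩

/-- Multiplication of two-covariant tensors by a constant. -/
def BCov.scale (c : ℝ) (u : BCov M) : BCov M := ⟨u.1, c • u.2⟩

variable (M) in
/-- Smooth cross-sections of the bundle of curvature-type tensors. -/
structure RiemSection where
  /-- the value at each point -/
  toFun : ∀ q : M, Curv q
  smooth : ∀ e ∈ Charts M, ContDiffOn ℝ ∞ (curvFieldComp e toFun) e.target

/-- A field of curvature-type tensors pushed forward by a diffeomorphism. -/
def pushField (φ : Diff M) (R : ∀ q : M, Curv q) (q : M) : Curv q :=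
  curvTransport (diffEquiv φ.symm q).symm (R (φ.symm q))

/-- The chart `e ∘ φ`. -/
def pullChart (φ : Diff M) (e : OpenPartialHomeomorph M E4) : OpenPartialHomeomorph M E4 :=
  φ.toHomeomorph.toOpenPartialHomeomorph ≫ₕ e

theorem pullChart_apply (φ : Diff M) (e : OpenPartialHomeomorph M E4) (p : M) :
    pullChart φ e p = e (φ p) := rfl

theorem pullChart_symm_apply (φ : Diff M) (e : OpenPartialHomeomorph M E4) (x : E4) :
    (pullChart φ e).symm x = φ.symm (e.symm x) := rfl

theorem mem_pullChart_source (φ : Diff M) (e : OpenPartialHomeomorph M E4) (p : M) :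
    p ∈ (pullChart φ e).source ↔ φ p ∈ e.source := by
  simp [pullChart]

theorem pullChart_target (φ : Diff M) (e : OpenPartialHomeomorph M E4) :
    (pullChart φ e).target = e.target := by
  simp [pullChart]

theorem pullChart_mem [IsManifold 𝓘(ℝ, E4) ∞ M] (φ : Diff M)
    {e : OpenPartialHomeomorph M E4} (he : e ∈ Charts M) : pullChart φ e ∈ Charts M := by
  apply OpenPartialHomeomorph.mem_maximalAtlas_of_contMDiffOn
  · exact (contMDiffOn_of_mem_maximalAtlas he).comp φ.contMDiff.contMDiffOn
      fun p hp => (mem_pullChart_source φ e p).1 hp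
  · rw [pullChart_target]
    exact φ.symm.contMDiff.comp_contMDiffOn (contMDiffOn_symm_of_mem_maximalAtlas he)

theorem diffEquiv_apply (φ : Diff M) (p : M) (v : Tan p) :
    diffEquiv φ p v = mfderiv 𝓘(ℝ, E4) 𝓘(ℝ, E4) φ p v := rfl

theorem diffEquiv_coordVec [IsManifold 𝓘(ℝ, E4) ∞ M] (φ : Diff M)
    {e : OpenPartialHomeomorph M E4} (he : e ∈ Charts M) {q : M} (hq : q ∈ e.source) (i : Fin 4) :
    diffEquiv φ.symm q (coordVec e q i) = coordVec (pullChart φ e) (φ.symm q) i := by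
  have h1 : (pullChart φ e) (φ.symm q) = e q := by simp [pullChart_apply]
  have h2 : MDifferentiableAt 𝓘(ℝ, E4) 𝓘(ℝ, E4) e.symm (e q) :=
    (contMDiffAt_symm_of_mem_maximalAtlas he (e.map_source hq)).mdifferentiableAt (by simp)
  have h3 : MDifferentiableAt 𝓘(ℝ, E4) 𝓘(ℝ, E4) φ.symm q :=
    φ.symm.contMDiff.contMDiffAt.mdifferentiableAt (by simp)
  have h4 := mfderiv_comp_apply_of_eq (x := e q) h3 h2 (e.left_inv hq) (stdVec i)
  unfold coordVec
  rw [h1]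
  exact h4.symm

theorem coordCov_diffEquiv [IsManifold 𝓘(ℝ, E4) ∞ M] (φ : Diff M)
    {e : OpenPartialHomeomorph M E4} (he : e ∈ Charts M) {q : M} (hq : q ∈ e.source) (l : Fin 4)
    (w : Tan (φ.symm q)) :
    coordCov e q l ((diffEquiv φ.symm q).symm w) = coordCov (pullChart φ e) (φ.symm q) l w := by
  obtain ⟨z, rfl⟩ := (diffEquiv φ.symm q).surjective w
  rw [LinearEquiv.symm_apply_apply]
  have hs : φ.symm q ∈ (pullChart φ e).source := by
    rw [mem_pullChart_source]; simpa using hq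
  have h1 : MDifferentiableAt 𝓘(ℝ, E4) 𝓘(ℝ, E4) (pullChart φ e) (φ.symm q) :=
    (contMDiffAt_of_mem_maximalAtlas (pullChart_mem φ he) hs).mdifferentiableAt (by simp)
  have h3 : MDifferentiableAt 𝓘(ℝ, E4) 𝓘(ℝ, E4) φ.symm q :=
    φ.symm.contMDiff.contMDiffAt.mdifferentiableAt (by simp)
  have h4 := mfderiv_comp_apply (x := q) h1 h3 z
  have h5 : (pullChart φ e) ∘ φ.symm = e := by
    funext y; simp [pullChart_apply]
  rw [h5] at h4
  exact congrArg (fun y : E4 => y l) h4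

theorem curvFieldComp_pushField [IsManifold 𝓘(ℝ, E4) ∞ M] (φ : Diff M)
    {e : OpenPartialHomeomorph M E4} (he : e ∈ Charts M) (R : ∀ q : M, Curv q)
    {x : E4} (hx : x ∈ e.target) :
    curvFieldComp e (pushField φ R) x = curvFieldComp (pullChart φ e) R x := by
  funext i j k l
  have hq := e.map_target hx
  change coordCov e (e.symm x) l ((diffEquiv φ.symm (e.symm x)).symm
    ((R (φ.symm (e.symm x))).1 (diffEquiv φ.symm (e.symm x) (coordVec e (e.symm x) i))
      (diffEquiv φ.symm (e.symm x) (coordVec e (e.symm x) j))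
      (diffEquiv φ.symm (e.symm x) (coordVec e (e.symm x) k)))) = _
  rw [diffEquiv_coordVec φ he hq, diffEquiv_coordVec φ he hq, diffEquiv_coordVec φ he hq,
    coordCov_diffEquiv φ he hq]
  rfl

/-- The action of a diffeomorphism on cross-sections. -/
def RiemSection.push [IsManifold 𝓘(ℝ, E4) ∞ M] (φ : Diff M) (R : RiemSection M) :
    RiemSection M where
  toFun := pushField φ R.toFun
  smooth e he := by
    have h := R.smooth _ (pullChart_mem φ he)
    rw [pullChart_target] at h
    exact h.congr fun x hx => curvFieldComp_pushField φ he R.toFun hx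

/-! ### Jets -/

/-- Two cross-sections osculate to order `n` at `p`: they have the same value at `p`, and the same
partial derivatives up to order `n` at `p` in each chart around `p`. -/
def Osculate (n : ℕ) (p : M) (R S : RiemSection M) : Prop :=
  R.toFun p = S.toFun p ∧ ∀ e ∈ Charts M, p ∈ e.source → ∀ k ≤ n,
    iteratedFDeriv ℝ k (curvFieldComp e R.toFun) (e p) =
      iteratedFDeriv ℝ k (curvFieldComp e S.toFun) (e p)

/-- Osculation to order `n` at `p` is an equivalence relation. -/
def osculateSetoid (n : ℕ) (p : M) : Setoid (RiemSection M) where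
  r := Osculate n p
  iseqv :=
    { refl := fun _ => ⟨rfl, fun _ _ _ _ _ => rfl⟩
      symm := fun h => ⟨h.1.symm, fun e he hp k hk => (h.2 e he hp k hk).symm⟩
      trans := fun h h' => ⟨h.1.trans h'.1, fun e he hp k hk =>
        (h.2 e he hp k hk).trans (h'.2 e he hp k hk)⟩ }

variable (M) in
/-- The bundle space `Jⁿ` of `n`-jets of cross-sections of the bundle of curvature-type tensors. -/
abbrev JetRiem (n : ℕ) : Type _ := Σ p : M, Quotient (osculateSetoid n p)

/-- The `n`-jet of a cross-section at `p`. -/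
def jet (n : ℕ) (p : M) (R : RiemSection M) : JetRiem M n :=
  ⟨p, Quotient.mk (osculateSetoid n p) R⟩

/-- The truncation of an `n`-jet to its target, the value at `p` of the cross-section. -/
def JetRiem.target {n : ℕ} (u : JetRiem M n) : BRiem M :=
  ⟨u.1, Quotient.lift (s := osculateSetoid n u.1) (fun R => R.toFun u.1) (fun _ _ h => h.1) u.2⟩

theorem Osculate.push [IsManifold 𝓘(ℝ, E4) ∞ M] (φ : Diff M) {n : ℕ} {p : M}
    {R S : RiemSection M} (h : Osculate n p R S) :
    Osculate n (φ p) (R.push φ) (S.push φ) := by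
  refine ⟨?_, fun e he hp k hk => ?_⟩
  · have key : ∀ q, q = p → R.toFun q = S.toFun q := by
      rintro q rfl
      exact h.1
    change pushField φ R.toFun (φ p) = pushField φ S.toFun (φ p)
    unfold pushField
    rw [key _ (φ.symm_apply_apply p)]
  · have hk' := h.2 _ (pullChart_mem φ he) ((mem_pullChart_source φ e p).2 hp) k hk
    have hn : e.target ∈ 𝓝 (e (φ p)) := e.open_target.mem_nhds (e.map_source hp)
    have aux : ∀ Q : RiemSection M,
        iteratedFDeriv ℝ k (curvFieldComp e (Q.push φ).toFun) (e (φ p)) =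
          iteratedFDeriv ℝ k (curvFieldComp (pullChart φ e) Q.toFun) (e (φ p)) := fun Q => by
      have hev : curvFieldComp e (Q.push φ).toFun =ᶠ[𝓝 (e (φ p))]
          curvFieldComp (pullChart φ e) Q.toFun := by
        filter_upwards [hn] with x hx
        exact curvFieldComp_pushField φ he Q.toFun hx
      exact (hev.iteratedFDeriv ℝ k).eq_of_nhds
    rw [aux R, aux S]
    exact hk'

/-- The action of a diffeomorphism on the bundle of `n`-jets, through its action on
cross-sections. -/
def jetInduction [IsManifold 𝓘(ℝ, E4) ∞ M] {n : ℕ} (φ : Diff M) (u : JetRiem M n) : JetRiem M n :=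
  ⟨φ u.1, Quotient.map' (s₁ := osculateSetoid n u.1) (s₂ := osculateSetoid n (φ u.1))
    (RiemSection.push φ) (fun _ _ h => Osculate.push φ h) u.2⟩

/-! ### Smooth mappings between the bundles -/

/-- The coordinate space of `n`-jets: the coordinates of the point, and the derivatives of
orders `0, …, n` of the components of a cross-section. -/
abbrev JetCoord (n : ℕ) : Type :=
  E4 × ((k : Fin (n + 1)) → E4 [×(k : ℕ)]→L[ℝ] TriArr)

open Classical in
/-- The coordinates of an `n`-jet in the chart induced by the chart `e` of `M` (with value `0`
outside of its domain). -/
def jetCoord (n : ℕ) (e : OpenPartialHomeomorph M E4) (u : JetRiem M n) : JetCoord n :=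
  (e u.1, Quotient.lift (s := osculateSetoid n u.1)
    (fun R => if e ∈ Charts M ∧ u.1 ∈ e.source then
      fun k : Fin (n + 1) => iteratedFDeriv ℝ k (curvFieldComp e R.toFun) (e u.1) else 0)
    (by
      intro R S h
      by_cases hc : e ∈ Charts M ∧ u.1 ∈ e.source
      · simp only [if_pos hc]
        funext k
        exact h.2 e hc.1 hc.2 k (Nat.lt_succ_iff.mp k.2)
      · simp only [if_neg hc]) u.2)

/-- The coordinates of a curvature-type tensor in the chart induced by the chart `e` of `M`. -/
def riemCoord (e : OpenPartialHomeomorph M E4) (u : BRiem M) : E4 × TriArr :=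
  (e u.1, triComp e u.1 u.2.1)

/-- The coordinates of a two-covariant tensor in the chart induced by the chart `e` of `M`. -/
def covCoord (e : OpenPartialHomeomorph M E4) (u : BCov M) : E4 × CovArr :=
  (e u.1, covComp e u.1 u.2)

/-- Smoothness of a mapping between spaces over `M` whose charts are induced by those of `M`.
The charts of the source are given by `cX e`, defined over `e.source`, with values in a normed
space `VX`, in which they fill a piece of a linear subspace (arrays of components of derivatives
obey linear symmetries); so smoothness near a point means that the coordinate expression extends
to a smooth mapping on an open set of `VX`. -/
def IsSmoothMap {X Y VX VY : Type*} [NormedAddCommGroup VX] [NormedSpace ℝ VX]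
    [NormedAddCommGroup VY] [NormedSpace ℝ VY]
    (πX : X → M) (cX : OpenPartialHomeomorph M E4 → X → VX)
    (πY : Y → M) (cY : OpenPartialHomeomorph M E4 → Y → VY) (f : X → Y) : Prop :=
  ∀ e ∈ Charts M, ∀ e' ∈ Charts M, ∀ u : X, πX u ∈ e.source → πY (f u) ∈ e'.source →
    ∃ N : Set VX, IsOpen N ∧ cX e u ∈ N ∧ ∃ F : VX → VY, ContDiffOn ℝ ∞ F N ∧
      ∀ v : X, πX v ∈ e.source → cX e v ∈ N →
        πY (f v) ∈ e'.source ∧ cY e' (f v) = F (cX e v)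

/-! ### Concomitants of the Riemann tensor -/

/-- A zeroth-order concomitant of the Riemann tensor with two covariant indices: a smooth mapping
from the bundle of curvature-type tensors that commutes with all diffeomorphisms of `M`. -/
structure IsZerothOrderConcomitant (χ : BRiem M → BCov M) : Prop where
  smooth : IsSmoothMap Sigma.fst riemCoord Sigma.fst covCoord χ
  equivariant : ∀ (φ : Diff M) (u : BRiem M), χ (riemInduction φ u) = covInduction φ (χ u)

/-- A concomitant of the Riemann tensor with two covariant indices, of order at most `n`: a smooth
mapping from the bundle of `n`-jets that commutes with all diffeomorphisms of `M`. -/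
structure IsConcomitant [IsManifold 𝓘(ℝ, E4) ∞ M] {n : ℕ} (χ : JetRiem M n → BCov M) : Prop where
  smooth : IsSmoothMap Sigma.fst (jetCoord n) Sigma.fst covCoord χ
  equivariant : ∀ (φ : Diff M) (u : JetRiem M n), χ (jetInduction φ u) = covInduction φ (χ u)

/-- A mapping on `n`-jets is a zeroth-order concomitant when it is the composite of the truncation
of a jet to its target with a zeroth-order concomitant. -/
def IsOfOrderZero {n : ℕ} (χ : JetRiem M n → BCov M) : Prop :=
  ∃ χ₀ : BRiem M → BCov M, IsZerothOrderConcomitant χ₀ ∧ ∀ u, χ u = χ₀ u.target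

/-! ### Lorentz metrics and their Riemann tensors -/

/-- `g` is a smooth Lorentz metric of signature `(+,-,-,-)` on the open set `U`. -/
structure IsLorentzMetricOn (U : Set M) (g : ∀ q : M, Cov q) : Prop where
  isOpen : IsOpen U
  lorentz : ∀ q ∈ U, IsLorentz (g q)
  smooth : ∀ e ∈ Charts M, ContDiffOn ℝ ∞ (covFieldComp e g) (e.target ∩ e.symm ⁻¹' U)

/-- The partial derivative `∂f/∂xⁱ`. -/
def pd (i : Fin 4) (f : E4 → ℝ) (x : E4) : ℝ := fderiv ℝ f x (stdVec i)

/-- The Christoffel symbols `Γ^l_{jk}` of a metric with components `G` in coordinates. -/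
def christoffel (G : E4 → CovArr) (l j k : Fin 4) (x : E4) : ℝ :=
  (1 / 2) * ∑ m, (Matrix.of (G x))⁻¹ l m *
    (pd j (fun y => G y m k) x + pd k (fun y => G y m j) x - pd m (fun y => G y j k) x)

/-- The components `R_{ijk}^l` of the Riemann tensor of a metric with components `G`, with
`R(∂_i, ∂_j) ∂_k = R_{ijk}^l ∂_l = ∇_i ∇_j ∂_k - ∇_j ∇_i ∂_k`. -/
def riemannArr (G : E4 → CovArr) (x : E4) : TriArr := fun i j k l =>
  pd i (christoffel G l j k) x - pd j (christoffel G l i k) x +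
    ∑ m, (christoffel G l i m x * christoffel G m j k x -
      christoffel G l j m x * christoffel G m i k x)

/-- The Riemann tensor `R_{abc}^d` at `q` of a metric `g` defined near `q`, that is,
`R_{ijk}^l dxⁱ ⊗ dxʲ ⊗ dxᵏ ⊗ ∂_l`, computed in the preferred chart at `q`. -/
def riemannTensor (g : ∀ q : M, Cov q) (q : M) : Tri q :=
  let e := chartAt E4 q
  ∑ i, ∑ j, ∑ k, ∑ l, riemannArr (covFieldComp e g) (e q) i j k l •
    (coordCov e q i).smulRight ((coordCov e q j).smulRight
      ((coordCov e q k).smulRight (coordVec e q l)))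

/-- A concomitant of the Riemann tensor is homogeneous of weight `w` under constant rescaling of
the metric: if `R` is near `p` the Riemann tensor of a Lorentz metric `g`, and `R'` that of `ξ g`
for a constant `ξ > 0`, then the value of `χ` at `p` for `R'` is `ξ ^ w` times that for `R`. -/
def IsHomogeneousInMetric {n : ℕ} (χ : JetRiem M n → BCov M) (w : ℝ) : Prop :=
  ∀ (U : Set M) (g : ∀ q : M, Cov q), IsLorentzMetricOn U g → ∀ ξ : ℝ, 0 < ξ →
    ∀ p ∈ U, ∀ R R' : RiemSection M,
      (∀ᶠ q in 𝓝 p, (R.toFun q).1 = riemannTensor g q) →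
      (∀ᶠ q in 𝓝 p, (R'.toFun q).1 = riemannTensor (fun q => ξ • g q) q) →
      χ (jet n p R') = (χ (jet n p R)).scale (ξ ^ w)

end Manifold

end Concom

end

open Concom

/-!
Both sides of the equivalence hold for every concomitant `χ`.

The Christoffel symbols, hence the Riemann tensor `R_{abc}^d`, do not change when the metric is
multiplied by a constant (`christoffel_smul`, `riemannTensor_smul`), so a mapping on jets of order
zero is homogeneous of weight `0` (`IsOfOrderZero.isHomogeneousInMetric`).

Conversely, naturality alone forces order zero (`IsConcomitant.isOfOrderZero`). First, `χ` covers
the identity of `M`: for `p ≠ q` there is a diffeomorphism which is the identity near `p` and moves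
`q`; it fixes each jet at `p`, so no such jet is sent to a tensor at `q` (`IsConcomitant.fst_eq`).
Now take a diffeomorphism `φ` which, in a chart near its fixed point `p`, is the dilation of ratio
`μ > 1` (`exists_diffeo_dilation`), and put `t = μ⁻¹`. Pushing a cross-section forward by `φ`
multiplies the `k`-th derivative at `p` of its components by `t ^ (k + 2)`, since there are three
covariant indices and one contravariant index, and multiplies a tensor `S_{ab}` at `p` by `t ^ 2`.
Iterating, the coordinate expression `F` of `χ` satisfies
`F (t^{2m} D₀, t^{3m} D₁, …) = t^{2m} F (D₀, D₁, …)` for all `m`, and the arguments on the left tend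
to the zero jet, where `F` is differentiable and vanishes. Dividing by `t^{2m}` and letting `m` tend
to infinity shows that `F (D₀, D₁, …)` is the derivative of `F` at the zero jet applied to
`(D₀, 0, …, 0)` (`IsConcomitant.exists_linear`). So the value of `χ` depends only on the target of
the jet. The mapping it induces on tensors is smooth because each tensor extends to a cross-section
with constant components near its base point (`exists_section_of_value`), whose jet depends
smoothly on the tensor.

The diffeomorphisms are perturbations of the identity by contractions with compact support in a
chart, extended by the identity (`exists_homeomorph_id_add`, `exists_diffeo_id_add`).
-/

/-! ### Diffeomorphisms supported in a chart -/

/-- A smooth perturbation of the identity by a contraction is a diffeomorphism. -/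
theorem exists_homeomorph_id_add {E : Type*} [NormedAddCommGroup E] [NormedSpace ℝ E]
    [CompleteSpace E] {g : E → E} (hg : ContDiff ℝ ∞ g) {c : NNReal} (hl : LipschitzWith c g)
    (hc : c < 1) : ∃ f : E ≃ₜ E, (∀ x, f x = x + g x) ∧ ContDiff ℝ ∞ f.symm := by
  have happ : ApproximatesLinearOn (fun x => x + g x)
      ((ContinuousLinearEquiv.refl ℝ E : E ≃L[ℝ] E) : E →L[ℝ] E) Set.univ c := by
    intro x _ y _
    have := hl.dist_le_mul x y
    rw [dist_eq_norm, dist_eq_norm] at this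
    have h : x + g x - (y + g y) - (x - y) = g x - g y := by abel
    simpa [h] using this
  have hN : Subsingleton E ∨
      c < ‖((ContinuousLinearEquiv.refl ℝ E : E ≃L[ℝ] E).symm : E →L[ℝ] E)‖₊⁻¹ := by
    rcases subsingleton_or_nontrivial E with h | h
    · exact Or.inl h
    · right
      have : ‖((ContinuousLinearEquiv.refl ℝ E : E ≃L[ℝ] E).symm : E →L[ℝ] E)‖₊ = 1 := by
        simp
      simpa [this] using hc
  refine ⟨happ.toHomeomorph _ hN, fun x => rfl, ?_⟩
  rw [contDiff_iff_contDiffAt]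
  intro a
  set f := happ.toHomeomorph _ hN
  set x := f.symm a
  have hgd : HasFDerivAt g (fderiv ℝ g x) x :=
    (hg.differentiable (by simp) x).hasFDerivAt
  have hn : ‖-(fderiv ℝ g x)‖ < 1 := by
    rw [norm_neg]
    exact (norm_fderiv_le_of_lipschitz ℝ hl).trans_lt (by exact_mod_cast hc)
  let A : E ≃L[ℝ] E := ContinuousLinearEquiv.unitsEquiv ℝ E (Units.oneSub _ hn)
  refine f.toOpenPartialHomeomorph.contDiffAt_symm (f₀' := A) (by simp) ?_ ?_
  · have hA : (A : E →L[ℝ] E) = ContinuousLinearMap.id ℝ E + fderiv ℝ g x := by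
      ext v
      simp [A]
    rw [hA]
    exact (hasFDerivAt_id x).add hgd
  · exact (contDiff_id.add hg).contDiffAt

namespace Concom

section

variable {M : Type*} [TopologicalSpace M]

open Classical in
/-- The map which is `f` in the chart `e` and the identity outside of its domain. -/
noncomputable def extendChart (e : OpenPartialHomeomorph M E4) (f : E4 → E4) (q : M) : M :=
  if q ∈ e.source then e.symm (f (e q)) else q

theorem extendChart_of_mem {e : OpenPartialHomeomorph M E4} {f : E4 → E4} {q : M}
    (hq : q ∈ e.source) : extendChart e f q = e.symm (f (e q)) := if_pos hq

theorem extendChart_of_notMem_image {e : OpenPartialHomeomorph M E4} {f : E4 → E4} {K : Set E4}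
    (hf : ∀ x, x ∉ K → f x = x) {q : M} (hq : q ∉ e.symm '' K) :
    extendChart e f q = q := by
  by_cases h : q ∈ e.source
  · rw [extendChart_of_mem h, hf _ fun hk => hq ⟨e q, hk, e.left_inv h⟩, e.left_inv h]
  · exact if_neg h

theorem extendChart_inverse {e : OpenPartialHomeomorph M E4} {f f' : E4 → E4}
    (hff : ∀ x, f' (f x) = x) (ht : Set.MapsTo f e.target e.target) (q : M) :
    extendChart e f' (extendChart e f q) = q := by
  by_cases h : q ∈ e.source
  · have h1 := ht (e.map_source h)
    rw [extendChart_of_mem h, extendChart_of_mem (e.map_target h1), e.right_inv h1, hff,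
      e.left_inv h]
  · have h1 : extendChart e f q = q := if_neg h
    rw [h1]
    exact if_neg h

variable [ChartedSpace E4 M]

theorem contMDiff_extendChart [IsManifold 𝓘(ℝ, E4) ∞ M] [T2Space M]
    {e : OpenPartialHomeomorph M E4} (he : e ∈ Charts M) {f : E4 → E4} (hs : ContDiff ℝ ∞ f)
    {K : Set E4} (hK : IsCompact K) (hKt : K ⊆ e.target) (hf : ∀ x, x ∉ K → f x = x)
    (ht : Set.MapsTo f e.target e.target) :
    ContMDiff 𝓘(ℝ, E4) 𝓘(ℝ, E4) ∞ (extendChart e f) := by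
  intro q
  by_cases hq : q ∈ e.source
  · have h1 : ContMDiffAt 𝓘(ℝ, E4) 𝓘(ℝ, E4) ∞ (fun q => e.symm (f (e q))) q :=
      (contMDiffAt_symm_of_mem_maximalAtlas he (ht (e.map_source hq))).comp q
        ((hs.contMDiff.contMDiffAt).comp q (contMDiffAt_of_mem_maximalAtlas he hq))
    refine h1.congr_of_eventuallyEq ?_
    filter_upwards [e.open_source.mem_nhds hq] with y hy using extendChart_of_mem hy
  · have hcl : IsClosed (e.symm '' K) := (hK.image_of_continuousOn
      (e.continuousOn_symm.mono hKt)).isClosed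
    have hq' : q ∉ e.symm '' K := by
      rintro ⟨x, hx, rfl⟩
      exact hq (e.map_target (hKt hx))
    refine contMDiffAt_id.congr_of_eventuallyEq ?_
    filter_upwards [hcl.isOpen_compl.mem_nhds hq'] with y hy
    exact extendChart_of_notMem_image hf hy

/-- A contraction `g` supported in the image of a chart gives a diffeomorphism of the manifold,
equal to `x ↦ x + g x` in the chart and to the identity off the support. -/
theorem exists_diffeo_id_add [IsManifold 𝓘(ℝ, E4) ∞ M] [T2Space M]
    {e : OpenPartialHomeomorph M E4} (he : e ∈ Charts M) {g : E4 → E4} (hg : ContDiff ℝ ∞ g)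
    {c : NNReal} (hl : LipschitzWith c g) (hc : c < 1) (hcs : HasCompactSupport g)
    (ht : tsupport g ⊆ e.target) :
    ∃ φ : Diff M, (∀ q ∈ e.source, φ q ∈ e.source ∧ e (φ q) = e q + g (e q)) ∧
      ∀ q, q ∉ e.symm '' tsupport g → φ q = q := by
  obtain ⟨f, hf, hs⟩ := exists_homeomorph_id_add hg hl hc
  have hf0 : ∀ x, x ∉ tsupport g → f x = x := fun x hx => by
    rw [hf, image_eq_zero_of_notMem_tsupport hx, add_zero]
  have hfK : ∀ x, f x ∈ tsupport g ↔ x ∈ tsupport g := by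
    intro x
    constructor
    · intro h
      by_contra hx
      rw [hf0 x hx] at h
      exact hx h
    · intro h
      by_contra hx
      have := hf0 _ hx
      rw [f.injective this] at hx
      exact hx h
  have hf0' : ∀ x, x ∉ tsupport g → f.symm x = x := fun x hx => by
    rw [Homeomorph.symm_apply_eq, hf0 x hx]
  have hft : Set.MapsTo f e.target e.target := fun x hx => by
    by_cases h : x ∈ tsupport g
    · exact ht ((hfK x).2 h)
    · rwa [hf0 x h]
  have hft' : Set.MapsTo f.symm e.target e.target := fun x hx => by
    by_cases h : x ∈ tsupport g
    · refine ht ((hfK _).1 ?_)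
      rwa [f.apply_symm_apply]
    · rwa [hf0' x h]
  have hfs : ContDiff ℝ ∞ f := by
    have : (f : E4 → E4) = fun x => x + g x := funext hf
    rw [this]
    exact contDiff_id.add hg
  let φ : Diff M :=
    { toFun := extendChart e f
      invFun := extendChart e f.symm
      left_inv := extendChart_inverse f.symm_apply_apply hft
      right_inv := extendChart_inverse f.apply_symm_apply hft'
      contMDiff_toFun := contMDiff_extendChart he hfs hcs ht hf0 hft
      contMDiff_invFun := contMDiff_extendChart he hs hcs ht hf0' hft' }
  refine ⟨φ, fun q hq => ?_, fun q hq => extendChart_of_notMem_image hf0 hq⟩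
  have h1 : φ q = e.symm (f (e q)) := extendChart_of_mem hq
  have h2 := hft (e.map_source hq)
  rw [h1, ← hf]
  exact ⟨e.map_target h2, e.right_inv h2⟩

/-- For each smooth vector field `w` on the model space, some small multiple `ε • w` is, in the
chart `e` and near `p`, the displacement of a diffeomorphism of the manifold supported in a given
neighbourhood `O` of `p`. -/
theorem exists_diffeo_displacement [IsManifold 𝓘(ℝ, E4) ∞ M] [T2Space M]
    {e : OpenPartialHomeomorph M E4} (he : e ∈ Charts M) {p : M} (hp : p ∈ e.source)
    {w : E4 → E4} (hw : ContDiff ℝ ∞ w) {O : Set M} (hO : O ∈ 𝓝 p) :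
    ∃ φ : Diff M, ∃ ε : ℝ, 0 < ε ∧ (∀ᶠ q in 𝓝 p, e (φ q) = e q + ε • w (e q)) ∧
      (∀ q ∈ e.source, φ q ∈ e.source) ∧
      ∃ K : Set M, IsClosed K ∧ K ⊆ O ∧ ∀ q ∉ K, φ q = q := by
  have hT : e.target ∩ e.symm ⁻¹' O ∈ 𝓝 (e p) := by
    refine Filter.inter_mem (e.open_target.mem_nhds (e.map_source hp)) ?_
    refine (e.continuousAt_symm (e.map_source hp)).preimage_mem_nhds ?_
    rwa [e.left_inv hp]
  obtain ⟨r, hr, hrT⟩ := Metric.nhds_basis_closedBall.mem_iff.1 hT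
  let ρ : ContDiffBump (e p) := ⟨r / 2, r, by positivity, by linarith⟩
  let g₀ : E4 → E4 := fun x => ρ x • w x
  have hg₀ : ContDiff ℝ ∞ g₀ := ρ.contDiff.smul hw
  have hc₀ : HasCompactSupport g₀ := ρ.hasCompactSupport.smul_right
  have hs₀ : tsupport g₀ ⊆ Metric.closedBall (e p) r := by
    refine (tsupport_smul_subset_left _ _).trans ?_
    rw [ρ.tsupport_eq]
  obtain ⟨C, hC⟩ := hg₀.lipschitzWith_of_hasCompactSupport hc₀ (by simp)
  -- Half the inverse of `C + 1` makes the Lipschitz constant of `ε • g₀` smaller than `1`.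
  let ε : NNReal := (C + 1)⁻¹ / 2
  have hε : 0 < ε := by positivity
  let g : E4 → E4 := fun x => (ε : ℝ) • g₀ x
  have hg : ContDiff ℝ ∞ g := hg₀.const_smul (ε : ℝ)
  have hl : LipschitzWith (ε * C) g := by
    refine LipschitzWith.of_dist_le_mul fun x y => ?_
    rw [dist_smul₀, NNReal.coe_mul, mul_assoc]
    simpa using mul_le_mul_of_nonneg_left (hC.dist_le_mul x y) ε.2
  have hlt : ε * C < 1 := by
    rw [← NNReal.coe_lt_coe]
    have h2 : ((C : ℝ) + 1)⁻¹ * (C + 1) = 1 := inv_mul_cancel₀ (by positivity)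
    have h3 : 0 < ((C : ℝ) + 1)⁻¹ := by positivity
    simp only [ε, NNReal.coe_mul, NNReal.coe_div, NNReal.coe_inv, NNReal.coe_add, NNReal.coe_one,
      NNReal.coe_ofNat]
    nlinarith [C.2]
  have hsg : tsupport g ⊆ Metric.closedBall (e p) r :=
    (tsupport_smul_subset_right (fun _ => (ε : ℝ)) g₀).trans hs₀
  have hcg : HasCompactSupport g := hc₀.smul_left (f := fun _ => (ε : ℝ))
  obtain ⟨φ, h1, h2⟩ := exists_diffeo_id_add he hg hl hlt hcg
    (hsg.trans (hrT.trans Set.inter_subset_left))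
  refine ⟨φ, ε, hε, ?_, fun q hq => (h1 q hq).1, e.symm '' tsupport g, ?_, ?_, h2⟩
  · have h3 : ∀ᶠ x in 𝓝 (e p), ρ x = 1 := ρ.eventuallyEq_one
    filter_upwards [e.open_source.mem_nhds hp, (e.continuousAt hp).eventually h3] with q hq hq1
    rw [(h1 q hq).2]
    simp [g, g₀, hq1]
  · refine (IsCompact.image_of_continuousOn hcg (e.continuousOn_symm.mono ?_)).isClosed
    exact hsg.trans (hrT.trans Set.inter_subset_left)
  · rintro _ ⟨x, hx, rfl⟩
    exact (hrT (hsg hx)).2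

/-- Around each point there is a diffeomorphism which is a dilation in a given chart. -/
theorem exists_diffeo_dilation [IsManifold 𝓘(ℝ, E4) ∞ M] [T2Space M]
    {e : OpenPartialHomeomorph M E4} (he : e ∈ Charts M) {p : M} (hp : p ∈ e.source) :
    ∃ φ : Diff M, ∃ μ : ℝ, 1 < μ ∧ φ p = p ∧
      ∀ᶠ q in 𝓝 p, e (φ q) = e p + μ • (e q - e p) := by
  obtain ⟨φ, ε, hε, h1, h2, -⟩ := exists_diffeo_displacement he hp
    (w := fun x => x - e p) (contDiff_id.sub contDiff_const) Filter.univ_mem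
  refine ⟨φ, 1 + ε, by linarith, ?_, ?_⟩
  · have := h1.self_of_nhds
    refine e.injOn (h2 p hp) hp ?_
    simpa using this
  · filter_upwards [h1] with q hq
    rw [hq, add_smul, one_smul]
    abel

/-- Diffeomorphisms separate points: some diffeomorphism is the identity near `p` and moves `q`. -/
theorem exists_diffeo_eventually_id_and_ne [IsManifold 𝓘(ℝ, E4) ∞ M] [T2Space M] {p q : M}
    (hpq : p ≠ q) : ∃ φ : Diff M, (∀ᶠ y in 𝓝 p, φ y = y) ∧ φ q ≠ q := by
  have hq : q ∈ (chartAt E4 q).source := mem_chart_source E4 q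
  obtain ⟨φ, ε, hε, h1, -, K, hK, hKO, h2⟩ := exists_diffeo_displacement
    (IsManifold.chart_mem_maximalAtlas q) hq (w := fun _ => stdVec 0) contDiff_const
    (isOpen_compl_singleton.mem_nhds hpq.symm : ({p}ᶜ : Set M) ∈ 𝓝 q)
  refine ⟨φ, ?_, fun h => ?_⟩
  · have : p ∉ K := fun h => hKO h rfl
    filter_upwards [hK.isOpen_compl.mem_nhds this] with y hy using h2 y hy
  · have h3 := h1.self_of_nhds
    rw [h, left_eq_add] at h3
    rcases smul_eq_zero.1 h3 with h4 | h4
    · exact hε.ne' h4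
    · simp at h4

end

end Concom

/-! ### Frames and changes of chart -/

/-- A rescaling of the variable about `a` and of the value multiplies each derivative at `a` by a
power of the factor. -/
theorem iteratedFDeriv_smul_comp_homothety {E F : Type*} [NormedAddCommGroup E] [NormedSpace ℝ E]
    [NormedAddCommGroup F] [NormedSpace ℝ F] {f : E → F} {a : E} (hf : ContDiffAt ℝ ∞ f a)
    (c : ℝ) {t : ℝ} (ht : t ≠ 0) (k : ℕ) :
    iteratedFDeriv ℝ k (fun x => c • f (a + t • (x - a))) a =
      (c * t ^ k) • iteratedFDeriv ℝ k f a := by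
  let g : E ≃L[ℝ] E := ContinuousLinearEquiv.smulLeft (Units.mk0 t ht)
  have hg : ∀ x, g x = t • x := fun x => rfl
  let f₁ : E → F := fun z => f (z + a)
  have h0 : f₁ = fun z => f (z + a) := rfl
  have h1 : ∀ j x, iteratedFDeriv ℝ j f₁ x = iteratedFDeriv ℝ j f (x + a) := fun j x =>
    iteratedFDeriv_comp_add_right j a x
  have h2 : (fun x => f (a + t • (x - a))) = fun x => (f₁ ∘ g) (x + -a) := by
    funext x
    simp [f₁, hg, sub_eq_add_neg, add_comm]
  have h3 : iteratedFDeriv ℝ k (fun x => f (a + t • (x - a))) a =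
      t ^ k • iteratedFDeriv ℝ k f a := by
    rw [h2, iteratedFDeriv_comp_add_right, add_neg_cancel]
    have h4 := g.iteratedFDerivWithin_comp_right f₁ (x := 0) uniqueDiffOn_univ
      (Set.mem_univ _) k
    rw [Set.preimage_univ, iteratedFDerivWithin_univ, iteratedFDerivWithin_univ, h1, hg,
      smul_zero, zero_add] at h4
    rw [h4]
    ext v
    have := (iteratedFDeriv ℝ k f a).map_smul_univ (fun _ => t) v
    simpa [hg] using this
  have h5 : ContDiffAt ℝ ∞ (fun x => f (a + t • (x - a))) a := by
    refine ContDiffAt.comp a ?_ (by fun_prop)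
    simpa using hf
  have h6 := iteratedFDeriv_const_smul_apply (a := c) (i := k)
    (h5.of_le (by exact_mod_cast le_top))
  rw [mul_smul, ← h3, ← h6]
  rfl

namespace Concom

section

variable {M : Type*} [TopologicalSpace M] [ChartedSpace E4 M]

theorem mdifferentiable_of_mem_charts {e : OpenPartialHomeomorph M E4} (he : e ∈ Charts M) :
    e.MDifferentiable 𝓘(ℝ, E4) 𝓘(ℝ, E4) :=
  ⟨(contMDiffOn_of_mem_maximalAtlas he).mdifferentiableOn (by simp),
    (contMDiffOn_symm_of_mem_maximalAtlas he).mdifferentiableOn (by simp)⟩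

/-- The differential at `q` of the chart `e`, an isomorphism of the tangent space with the model
space. -/
noncomputable def frame {e : OpenPartialHomeomorph M E4} (he : e ∈ Charts M) {q : M}
    (hq : q ∈ e.source) : Tan q ≃ₗ[ℝ] E4 :=
  ((mdifferentiable_of_mem_charts he).mfderiv hq).toLinearEquiv

theorem frame_apply {e : OpenPartialHomeomorph M E4} (he : e ∈ Charts M) {q : M}
    (hq : q ∈ e.source) (v : Tan q) :
    frame he hq v = mfderiv 𝓘(ℝ, E4) 𝓘(ℝ, E4) e q v := rfl

theorem coordVec_eq {e : OpenPartialHomeomorph M E4} (he : e ∈ Charts M) {q : M}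
    (hq : q ∈ e.source) (i : Fin 4) : coordVec e q i = (frame he hq).symm (stdVec i) := rfl

theorem coordCov_eq {e : OpenPartialHomeomorph M E4} (he : e ∈ Charts M) {q : M}
    (hq : q ∈ e.source) (i : Fin 4) (v : Tan q) : coordCov e q i v = (frame he hq v) i := rfl

theorem linearMap_ext_stdVec {F : Type*} [AddCommGroup F] [Module ℝ F] {f g : E4 →ₗ[ℝ] F}
    (h : ∀ i, f (stdVec i) = g (stdVec i)) : f = g :=
  (EuclideanSpace.basisFun (Fin 4) ℝ).toBasis.ext fun i => by simpa using h i

/-- A two-covariant tensor is determined by its components in a chart. -/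
theorem covComp_injective {e : OpenPartialHomeomorph M E4} (he : e ∈ Charts M) {q : M}
    (hq : q ∈ e.source) : Function.Injective (covComp e q) := by
  intro S T h
  have key : ∀ i j, S ((frame he hq).symm (stdVec i)) ((frame he hq).symm (stdVec j)) =
      T ((frame he hq).symm (stdVec i)) ((frame he hq).symm (stdVec j)) := fun i j =>
    congrFun (congrFun h i) j
  have h1 : covTransport (frame he hq) S = covTransport (frame he hq) T :=
    linearMap_ext_stdVec fun i => linearMap_ext_stdVec fun j => key i j
  exact ((frame he hq).arrowCongr
    ((frame he hq).arrowCongr (LinearEquiv.refl ℝ ℝ))).injective h1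

theorem covCoord_injOn {e : OpenPartialHomeomorph M E4} (he : e ∈ Charts M) {u v : BCov M}
    (hu : u.1 ∈ e.source) (hv : v.1 ∈ e.source) (h : covCoord e u = covCoord e v) : u = v := by
  obtain ⟨p, S⟩ := u
  obtain ⟨q, T⟩ := v
  obtain rfl : p = q := e.injOn hu hv (congrArg Prod.fst h)
  exact congrArg (Sigma.mk p) (covComp_injective he hu (congrArg Prod.snd h))

theorem frame_eq_smul {e₁ e₂ : OpenPartialHomeomorph M E4} (h₁ : e₁ ∈ Charts M)
    (h₂ : e₂ ∈ Charts M) {q : M} (hq₁ : q ∈ e₁.source) (hq₂ : q ∈ e₂.source) {a : E4} {μ : ℝ}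
    (h : ∀ᶠ y in 𝓝 q, e₁ y = a + μ • (e₂ y - a)) (v : Tan q) :
    frame h₁ hq₁ v = μ • frame h₂ hq₂ v := by
  let l : E4 → E4 := fun x => a + μ • (x - a)
  have hl : HasFDerivAt l (μ • ContinuousLinearMap.id ℝ E4) (e₂ q) :=
    (((hasFDerivAt_id _).sub_const a).const_smul μ).const_add a
  have h3 : MDifferentiableAt 𝓘(ℝ, E4) 𝓘(ℝ, E4) e₂ q :=
    (contMDiffAt_of_mem_maximalAtlas h₂ hq₂).mdifferentiableAt (by simp)
  have h4 := mfderiv_comp_apply (x := q) hl.differentiableAt.mdifferentiableAt h3 v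
  have h5 : mfderiv 𝓘(ℝ, E4) 𝓘(ℝ, E4) e₁ q = mfderiv 𝓘(ℝ, E4) 𝓘(ℝ, E4) (l ∘ e₂) q :=
    Filter.EventuallyEq.mfderiv_eq (by filter_upwards [h] with y hy using hy)
  rw [frame_apply, frame_apply, h5]
  refine h4.trans ?_
  rw [mfderiv_eq_fderiv, hl.fderiv]
  rfl

theorem coordVec_eq_smul {e₁ e₂ : OpenPartialHomeomorph M E4} (h₁ : e₁ ∈ Charts M)
    (h₂ : e₂ ∈ Charts M) {q : M} (hq₁ : q ∈ e₁.source) (hq₂ : q ∈ e₂.source) {a : E4} {μ : ℝ}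
    (hμ : μ ≠ 0) (h : ∀ᶠ y in 𝓝 q, e₁ y = a + μ • (e₂ y - a)) (i : Fin 4) :
    coordVec e₁ q i = μ⁻¹ • coordVec e₂ q i := by
  rw [coordVec_eq h₁ hq₁, coordVec_eq h₂ hq₂, LinearEquiv.symm_apply_eq, map_smul,
    frame_eq_smul h₁ h₂ hq₁ hq₂ h, LinearEquiv.apply_symm_apply, inv_smul_smul₀ hμ]

theorem covComp_eq_smul {e₁ e₂ : OpenPartialHomeomorph M E4} (h₁ : e₁ ∈ Charts M)
    (h₂ : e₂ ∈ Charts M) {q : M} (hq₁ : q ∈ e₁.source) (hq₂ : q ∈ e₂.source) {a : E4} {μ : ℝ}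
    (hμ : μ ≠ 0) (h : ∀ᶠ y in 𝓝 q, e₁ y = a + μ • (e₂ y - a)) (S : Cov q) :
    covComp e₁ q S = μ⁻¹ ^ 2 • covComp e₂ q S := by
  funext i j
  simp only [covComp, coordVec_eq_smul h₁ h₂ hq₁ hq₂ hμ h, map_smul, LinearMap.smul_apply,
    Pi.smul_apply, smul_eq_mul]
  ring

theorem triComp_eq_smul {e₁ e₂ : OpenPartialHomeomorph M E4} (h₁ : e₁ ∈ Charts M)
    (h₂ : e₂ ∈ Charts M) {q : M} (hq₁ : q ∈ e₁.source) (hq₂ : q ∈ e₂.source) {a : E4} {μ : ℝ}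
    (hμ : μ ≠ 0) (h : ∀ᶠ y in 𝓝 q, e₁ y = a + μ • (e₂ y - a)) (R : Tri q) :
    triComp e₁ q R = μ⁻¹ ^ 2 • triComp e₂ q R := by
  funext i j k l
  have h3 : ∀ v, coordCov e₁ q l v = μ * coordCov e₂ q l v := fun v => by
    rw [coordCov_eq h₁ hq₁, coordCov_eq h₂ hq₂, frame_eq_smul h₁ h₂ hq₁ hq₂ h]
    rfl
  simp only [triComp, coordVec_eq_smul h₁ h₂ hq₁ hq₂ hμ h, map_smul, LinearMap.smul_apply,
    Pi.smul_apply, smul_eq_mul, h3]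
  field_simp

/-- If two charts differ near `p` by the dilation of ratio `μ` about `e₂ p`, the components of a
field of curvature-type tensors differ by the factor `μ⁻²`: there are three covariant indices and
a contravariant one. -/
theorem curvFieldComp_eventuallyEq_of_dilation {e₁ e₂ : OpenPartialHomeomorph M E4}
    (h₁ : e₁ ∈ Charts M) (h₂ : e₂ ∈ Charts M) {p : M} (hp₁ : p ∈ e₁.source) (hp₂ : p ∈ e₂.source)
    {μ : ℝ} (hμ : μ ≠ 0) (h : ∀ᶠ y in 𝓝 p, e₁ y = e₂ p + μ • (e₂ y - e₂ p))
    (R : ∀ q : M, Curv q) :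
    curvFieldComp e₁ R =ᶠ[𝓝 (e₂ p)]
      fun x => μ⁻¹ ^ 2 • curvFieldComp e₂ R (e₂ p + μ⁻¹ • (x - e₂ p)) := by
  have hp : e₁ p = e₂ p := by simpa using h.self_of_nhds
  have hc : Filter.Tendsto e₁.symm (𝓝 (e₂ p)) (𝓝 p) := by
    have := e₁.continuousAt_symm (e₁.map_source hp₁)
    rw [ContinuousAt, e₁.left_inv hp₁, hp] at this
    exact this
  have ht : e₁.target ∈ 𝓝 (e₂ p) := by
    rw [← hp]
    exact e₁.open_target.mem_nhds (e₁.map_source hp₁)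
  filter_upwards [hc.eventually h.eventually_nhds, ht,
    hc.eventually (e₂.open_source.mem_nhds hp₂)] with x hx hxt hx₂
  have hx₁ := e₁.map_target hxt
  have h3 : e₂ (e₁.symm x) = e₂ p + μ⁻¹ • (x - e₂ p) := by
    have := hx.self_of_nhds
    rw [e₁.right_inv hxt] at this
    rw [sub_eq_iff_eq_add'.2 this, inv_smul_smul₀ hμ, add_sub_cancel]
  have h4 : e₂.symm (e₂ p + μ⁻¹ • (x - e₂ p)) = e₁.symm x := by
    rw [← h3]
    exact e₂.left_inv hx₂
  unfold curvFieldComp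
  rw [h4]
  exact triComp_eq_smul h₁ h₂ hx₁ hx₂ hμ hx _

theorem contDiffAt_curvFieldComp (R : RiemSection M) {e : OpenPartialHomeomorph M E4}
    (he : e ∈ Charts M) {p : M} (hp : p ∈ e.source) :
    ContDiffAt ℝ ∞ (curvFieldComp e R.toFun) (e p) :=
  (R.smooth e he).contDiffAt (e.open_target.mem_nhds (e.map_source hp))

/-! ### Dilations on jets and tensors -/

/-- A diffeomorphism which is a dilation of ratio `μ` in the chart `e` near its fixed point `p`. -/
structure IsDilationAt (φ : Diff M) (e : OpenPartialHomeomorph M E4) (p : M) (μ : ℝ) : Prop where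
  fixed : φ p = p
  apply : ∀ᶠ y in 𝓝 p, e (φ y) = e p + μ • (e y - e p)

variable [IsManifold 𝓘(ℝ, E4) ∞ M]

/-- The `k`-th derivative of the components scales with the power `k + 2` of the inverse ratio. -/
theorem iteratedFDeriv_push_of_isDilationAt {φ : Diff M} {e : OpenPartialHomeomorph M E4} {p : M}
    {μ : ℝ} (h : IsDilationAt φ e p μ) (he : e ∈ Charts M) (hp : p ∈ e.source) (hμ : μ ≠ 0)
    (R : RiemSection M) (k : ℕ) :
    iteratedFDeriv ℝ k (curvFieldComp e (R.push φ).toFun) (e p) =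
      (μ⁻¹ ^ 2 * μ⁻¹ ^ k) • iteratedFDeriv ℝ k (curvFieldComp e R.toFun) (e p) := by
  have hps : p ∈ (pullChart φ e).source := by rwa [mem_pullChart_source, h.fixed]
  have h1 : curvFieldComp e (R.push φ).toFun =ᶠ[𝓝 (e p)]
      curvFieldComp (pullChart φ e) R.toFun := by
    filter_upwards [e.open_target.mem_nhds (e.map_source hp)] with x hx
    exact curvFieldComp_pushField φ he R.toFun hx
  have h2 := h1.trans (curvFieldComp_eventuallyEq_of_dilation (pullChart_mem φ he) he hps hp hμ
    h.apply R.toFun)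
  rw [(h2.iteratedFDeriv ℝ k).eq_of_nhds]
  exact iteratedFDeriv_smul_comp_homothety (contDiffAt_curvFieldComp R he hp) _
    (inv_ne_zero hμ) k

theorem diffEquiv_coordVec_pullChart (φ : Diff M) {e : OpenPartialHomeomorph M E4}
    (he : e ∈ Charts M) {q : M} (hq : φ q ∈ e.source) (i : Fin 4) :
    diffEquiv φ q (coordVec (pullChart φ e) q i) = coordVec e (φ q) i := by
  have hs : q ∈ (pullChart φ e).source := (mem_pullChart_source φ e q).2 hq
  have h2 : MDifferentiableAt 𝓘(ℝ, E4) 𝓘(ℝ, E4) (pullChart φ e).symm (pullChart φ e q) :=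
    (contMDiffAt_symm_of_mem_maximalAtlas (pullChart_mem φ he)
      ((pullChart φ e).map_source hs)).mdifferentiableAt (by simp)
  have h3 : MDifferentiableAt 𝓘(ℝ, E4) 𝓘(ℝ, E4) φ q :=
    φ.contMDiff.contMDiffAt.mdifferentiableAt (by simp)
  have h4 := mfderiv_comp_apply_of_eq (x := pullChart φ e q) h3 h2
    ((pullChart φ e).left_inv hs) (stdVec i)
  have h5 : φ ∘ (pullChart φ e).symm = e.symm := by
    funext x
    simp [pullChart_symm_apply]
  rw [h5] at h4
  exact h4.symm

theorem covComp_covTransport (φ : Diff M) {e : OpenPartialHomeomorph M E4}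
    (he : e ∈ Charts M) {q : M} (hq : φ q ∈ e.source) (S : Cov q) :
    covComp e (φ q) (covTransport (diffEquiv φ q) S) = covComp (pullChart φ e) q S := by
  funext i j
  change S ((diffEquiv φ q).symm (coordVec e (φ q) i))
    ((diffEquiv φ q).symm (coordVec e (φ q) j)) = _
  rw [← diffEquiv_coordVec_pullChart φ he hq, ← diffEquiv_coordVec_pullChart φ he hq,
    LinearEquiv.symm_apply_apply, LinearEquiv.symm_apply_apply]
  rfl

theorem covComp_covInduction_of_isDilationAt {φ : Diff M} {e : OpenPartialHomeomorph M E4}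
    {p : M} {μ : ℝ} (h : IsDilationAt φ e p μ) (he : e ∈ Charts M) (hp : p ∈ e.source)
    (hμ : μ ≠ 0) {u : BCov M} (hu : u.1 = p) :
    (covCoord e (covInduction φ u)).2 = μ⁻¹ ^ 2 • (covCoord e u).2 := by
  obtain ⟨q, S⟩ := u
  obtain rfl : q = p := hu
  have hp' : φ q ∈ e.source := by rwa [h.fixed]
  exact (covComp_covTransport φ he hp' S).trans (covComp_eq_smul (pullChart_mem φ he) he
    ((mem_pullChart_source φ e q).2 hp') hp hμ h.apply S)

end

/-! ### Cross-sections with given local components -/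

theorem contDiffAt_trilinear {E : Type*} [NormedAddCommGroup E] [NormedSpace ℝ E]
    (T : E4 →ₗ[ℝ] E4 →ₗ[ℝ] E4 →ₗ[ℝ] E4) {a b c : E → E4} {x : E} (ha : ContDiffAt ℝ ∞ a x)
    (hb : ContDiffAt ℝ ∞ b x) (hc : ContDiffAt ℝ ∞ c x) :
    ContDiffAt ℝ ∞ (fun y => T (a y) (b y) (c y)) x := by
  have hexp : ∀ {F : Type} [AddCommGroup F] [Module ℝ F] (f : E4 →ₗ[ℝ] F) (v : E4),
      f v = ∑ i, v i • f (stdVec i) := fun f v => by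
    have hv : ∑ i, v i • stdVec i = v := by
      simpa using (EuclideanSpace.basisFun (Fin 4) ℝ).sum_repr v
    conv_lhs => rw [← hv, map_sum]
    simp only [map_smul]
  have hT : (fun y => T (a y) (b y) (c y)) = fun y => ∑ i, ∑ j, ∑ k,
      (a y i * b y j * c y k) • T (stdVec i) (stdVec j) (stdVec k) := by
    funext y
    rw [hexp T (a y)]
    simp only [LinearMap.sum_apply, LinearMap.smul_apply]
    refine Finset.sum_congr rfl fun i _ => ?_
    rw [hexp (T (stdVec i)) (b y)]
    simp only [LinearMap.sum_apply, LinearMap.smul_apply]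
    rw [Finset.smul_sum]
    refine Finset.sum_congr rfl fun j _ => ?_
    rw [hexp (T (stdVec i) (stdVec j)) (c y), Finset.smul_sum, Finset.smul_sum]
    refine Finset.sum_congr rfl fun k _ => ?_
    rw [smul_smul, smul_smul]
  have hco : ∀ {f : E → E4}, ContDiffAt ℝ ∞ f x → ∀ i, ContDiffAt ℝ ∞ (fun y => f y i) x :=
    fun hf i => (contDiffAt_piLp_apply 2).comp x hf
  rw [hT]
  exact ContDiffAt.sum fun i _ => ContDiffAt.sum fun j _ => ContDiffAt.sum fun k _ =>
    (((hco ha i).mul (hco hb j)).mul (hco hc k)).smul contDiffAt_const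

section

variable {M : Type*} [TopologicalSpace M] [ChartedSpace E4 M]

theorem contDiffAt_transition {e₁ e₂ : OpenPartialHomeomorph M E4} (h₁ : e₁ ∈ Charts M)
    (h₂ : e₂ ∈ Charts M) {q : M} (hq₁ : q ∈ e₁.source) (hq₂ : q ∈ e₂.source) :
    ContDiffAt ℝ ∞ (e₂ ∘ e₁.symm) (e₁ q) := by
  rw [← contMDiffAt_iff_contDiffAt]
  refine ContMDiffAt.comp (e₁ q) ?_
    (contMDiffAt_symm_of_mem_maximalAtlas h₁ (e₁.map_source hq₁))
  rw [e₁.left_inv hq₁]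
  exact contMDiffAt_of_mem_maximalAtlas h₂ hq₂

theorem frame_frame_symm {e₁ e₂ : OpenPartialHomeomorph M E4} (h₁ : e₁ ∈ Charts M)
    (h₂ : e₂ ∈ Charts M) {q : M} (hq₁ : q ∈ e₁.source) (hq₂ : q ∈ e₂.source) (v : E4) :
    frame h₂ hq₂ ((frame h₁ hq₁).symm v) = fderiv ℝ (e₂ ∘ e₁.symm) (e₁ q) v := by
  have h3 : MDifferentiableAt 𝓘(ℝ, E4) 𝓘(ℝ, E4) e₁.symm (e₁ q) :=
    (contMDiffAt_symm_of_mem_maximalAtlas h₁ (e₁.map_source hq₁)).mdifferentiableAt (by simp)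
  have h4 : MDifferentiableAt 𝓘(ℝ, E4) 𝓘(ℝ, E4) e₂ q :=
    (contMDiffAt_of_mem_maximalAtlas h₂ hq₂).mdifferentiableAt (by simp)
  have h5 := mfderiv_comp_apply_of_eq (x := e₁ q) h4 h3 (e₁.left_inv hq₁) v
  rw [mfderiv_eq_fderiv] at h5
  exact h5.symm

open Classical in
/-- The field whose components in the chart `e` are those of `T` multiplied by the function `ψ`,
extended by zero outside of the domain of the chart. -/
noncomputable def cutoffField {e : OpenPartialHomeomorph M E4} (he : e ∈ Charts M) (ψ : M → ℝ)
    (T : curvatureTensors E4) (q : M) : Curv q :=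
  if h : q ∈ e.source then ψ q • curvTransport (frame he h).symm T else 0

theorem cutoffField_of_eq_zero {e : OpenPartialHomeomorph M E4} (he : e ∈ Charts M) {ψ : M → ℝ}
    (T : curvatureTensors E4) {q : M} (hψ : ψ q = 0) : cutoffField he ψ T q = 0 := by
  unfold cutoffField
  split_ifs <;> simp [hψ]

theorem triComp_cutoffField {e e₁ : OpenPartialHomeomorph M E4} (he : e ∈ Charts M)
    (h₁ : e₁ ∈ Charts M) (ψ : M → ℝ) (T : curvatureTensors E4) {q : M} (hq : q ∈ e.source)
    (hq₁ : q ∈ e₁.source) (i j k l : Fin 4) :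
    triComp e₁ q (cutoffField he ψ T q).1 i j k l =
      ψ q * fderiv ℝ (e₁ ∘ e.symm) (e q) (T.1 (fderiv ℝ (e ∘ e₁.symm) (e₁ q) (stdVec i))
        (fderiv ℝ (e ∘ e₁.symm) (e₁ q) (stdVec j))
        (fderiv ℝ (e ∘ e₁.symm) (e₁ q) (stdVec k))) l := by
  rw [← frame_frame_symm h₁ he hq₁ hq, ← frame_frame_symm h₁ he hq₁ hq,
    ← frame_frame_symm h₁ he hq₁ hq, ← frame_frame_symm he h₁ hq hq₁]
  unfold triComp cutoffField
  rw [dif_pos hq, coordCov_eq h₁ hq₁, coordVec_eq h₁ hq₁, coordVec_eq h₁ hq₁, coordVec_eq h₁ hq₁]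
  simp only [Submodule.coe_smul, LinearMap.smul_apply, map_smul, PiLp.smul_apply, smul_eq_mul]
  rfl

/-- The field `cutoffField` is smooth if `ψ` is smooth with support in the domain of the chart. -/
theorem contDiffOn_cutoffField {e : OpenPartialHomeomorph M E4} (he : e ∈ Charts M) {ψ : M → ℝ}
    (hψ : ContMDiff 𝓘(ℝ, E4) 𝓘(ℝ, ℝ) ∞ ψ) (hs : tsupport ψ ⊆ e.source) (T : curvatureTensors E4)
    {e₁ : OpenPartialHomeomorph M E4} (h₁ : e₁ ∈ Charts M) :
    ContDiffOn ℝ ∞ (curvFieldComp e₁ (cutoffField he ψ T)) e₁.target := by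
  intro x hx
  refine ContDiffAt.contDiffWithinAt ?_
  have hq₁ := e₁.map_target hx
  have hcont : ContinuousAt e₁.symm x := e₁.continuousAt_symm hx
  by_cases hq : e₁.symm x ∈ e.source
  · have hev : curvFieldComp e₁ (cutoffField he ψ T) =ᶠ[𝓝 x] fun y i j k l =>
        ψ (e₁.symm y) * fderiv ℝ (e₁ ∘ e.symm) ((e ∘ e₁.symm) y)
          (T.1 (fderiv ℝ (e ∘ e₁.symm) y (stdVec i)) (fderiv ℝ (e ∘ e₁.symm) y (stdVec j))
            (fderiv ℝ (e ∘ e₁.symm) y (stdVec k))) l := by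
      filter_upwards [e₁.open_target.mem_nhds hx,
        hcont.preimage_mem_nhds (e.open_source.mem_nhds hq)] with y hy hye
      funext i j k l
      have := triComp_cutoffField he h₁ ψ T hye (e₁.map_target hy) i j k l
      rw [e₁.right_inv hy] at this
      exact this
    refine ContDiffAt.congr_of_eventuallyEq ?_ hev
    have ht : ContDiffAt ℝ ∞ (e ∘ e₁.symm) x := by
      simpa [e₁.right_inv hx] using contDiffAt_transition h₁ he hq₁ hq
    have ht' : ContDiffAt ℝ ∞ (e₁ ∘ e.symm) ((e ∘ e₁.symm) x) :=
      contDiffAt_transition he h₁ hq hq₁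
    have hD : ∀ i, ContDiffAt ℝ ∞ (fun y => fderiv ℝ (e ∘ e₁.symm) y (stdVec i)) x := fun i =>
      (ht.fderiv_right (m := ∞) (by simp)).clm_apply contDiffAt_const
    have hD' : ContDiffAt ℝ ∞ (fun y => fderiv ℝ (e₁ ∘ e.symm) ((e ∘ e₁.symm) y)) x :=
      (ht'.fderiv_right (m := ∞) (by simp)).comp x ht
    have hψ' : ContDiffAt ℝ ∞ (fun y => ψ (e₁.symm y)) x := by
      rw [← contMDiffAt_iff_contDiffAt]
      exact hψ.contMDiffAt.comp x (contMDiffAt_symm_of_mem_maximalAtlas h₁ hx)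
    refine contDiffAt_pi.2 fun i => contDiffAt_pi.2 fun j => contDiffAt_pi.2 fun k =>
      contDiffAt_pi.2 fun l => hψ'.mul ?_
    exact (contDiffAt_piLp_apply 2).comp x
      (hD'.clm_apply (contDiffAt_trilinear T.1 (hD i) (hD j) (hD k)))
  · have hq' : e₁.symm x ∉ tsupport ψ := fun h => hq (hs h)
    refine (contDiffAt_const (c := (0 : TriArr))).congr_of_eventuallyEq ?_
    filter_upwards [hcont.preimage_mem_nhds ((isClosed_tsupport ψ).isOpen_compl.mem_nhds hq')]
      with y hy
    unfold curvFieldComp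
    rw [cutoffField_of_eq_zero he T (image_eq_zero_of_notMem_tsupport hy)]
    funext i j k l
    simp [triComp]

/-- Each tensor at `p` is the value of a cross-section with constant components near `p`. -/
theorem exists_section_of_value [IsManifold 𝓘(ℝ, E4) ∞ M] [T2Space M]
    {e : OpenPartialHomeomorph M E4} (he : e ∈ Charts M) {p : M} (hp : p ∈ e.source)
    (T : Curv p) : ∃ R : RiemSection M, R.toFun p = T ∧
      curvFieldComp e R.toFun =ᶠ[𝓝 (e p)] fun _ => triComp e p T.1 := by
  obtain ⟨f, -, hf⟩ := (SmoothBumpFunction.nhds_basis_tsupport (I := 𝓘(ℝ, E4)) p).mem_iff.1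
    (e.open_source.mem_nhds hp)
  let T' : curvatureTensors E4 := curvTransport (frame he hp) T
  let R : RiemSection M := ⟨cutoffField he f T', fun e₁ h₁ =>
    contDiffOn_cutoffField he f.contMDiff hf T' h₁⟩
  have h1 : ∀ᶠ q in 𝓝 p, f q = 1 := f.eventuallyEq_one
  have hR : R.toFun p = T := by
    change cutoffField he f T' p = T
    unfold cutoffField
    rw [dif_pos hp, h1.self_of_nhds, one_smul]
    ext u v w
    simp [T', curvTransport, triTransport_apply]
  have hx : ∀ᶠ x in 𝓝 (e p), x ∈ e.target ∧ f (e.symm x) = 1 := by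
    refine Filter.Eventually.and (e.open_target.mem_nhds (e.map_source hp)) ?_
    have := e.continuousAt_symm (e.map_source hp)
    rw [ContinuousAt, e.left_inv hp] at this
    exact this.eventually h1
  have hc : ∀ x ∈ e.target, f (e.symm x) = 1 →
      curvFieldComp e R.toFun x = fun i j k l => T'.1 (stdVec i) (stdVec j) (stdVec k) l := by
    intro x hx hfx
    funext i j k l
    refine (triComp_cutoffField he he f T' (e.map_target hx) (e.map_target hx) i j k l).trans ?_
    simp only [← frame_frame_symm he he (e.map_target hx) (e.map_target hx),
      LinearEquiv.apply_symm_apply, hfx, one_mul]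
  refine ⟨R, hR, ?_⟩
  have hpc : triComp e p T.1 = fun i j k l => T'.1 (stdVec i) (stdVec j) (stdVec k) l := by
    funext i j k l
    rfl
  rw [hpc]
  filter_upwards [hx] with x hx using hc x hx.1 hx.2

end

section

variable {M : Type*} [TopologicalSpace M] [ChartedSpace E4 M]

/-! ### Jets and cross-sections -/

theorem curvFieldComp_apply_self {e : OpenPartialHomeomorph M E4} {p : M} (hp : p ∈ e.source)
    (R : ∀ q : M, Curv q) : curvFieldComp e R (e p) = triComp e p (R p).1 := by
  change (fun q => triComp e q (R q).1) (e.symm (e p)) = _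
  rw [e.left_inv hp]

theorem jetCoord_jet {n : ℕ} {e : OpenPartialHomeomorph M E4} (he : e ∈ Charts M) {p : M}
    (hp : p ∈ e.source) (R : RiemSection M) : jetCoord n e (jet n p R) =
      (e p, fun k : Fin (n + 1) => iteratedFDeriv ℝ k (curvFieldComp e R.toFun) (e p)) :=
  Prod.ext rfl (if_pos ⟨he, hp⟩)

theorem exists_eq_jet {n : ℕ} (u : JetRiem M n) : ∃ R : RiemSection M, u = jet n u.1 R := by
  obtain ⟨p, r⟩ := u
  obtain ⟨R, rfl⟩ := Quotient.exists_rep r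
  exact ⟨R, rfl⟩

/-- The derivatives of orders `0, …, n` of a constant array. -/
noncomputable def constJet (n : ℕ) (a : TriArr) :
    (k : Fin (n + 1)) → E4 [×(k : ℕ)]→L[ℝ] TriArr :=
  fun k => iteratedFDeriv ℝ k (fun _ => a) 0

theorem contDiff_constJet (n : ℕ) : ContDiff ℝ ∞ (constJet n) := by
  refine contDiff_pi.2 fun k => ?_
  obtain ⟨k, hk⟩ := k
  rcases k with - | k
  · have h : (fun a => constJet n a ⟨0, hk⟩) =
        (continuousMultilinearCurryFin0 ℝ E4 TriArr).symm := by
      funext a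
      simp only [constJet, iteratedFDeriv_zero_eq_comp, Function.comp_apply]
    rw [h]
    exact (continuousMultilinearCurryFin0 ℝ E4 TriArr).symm.contDiff
  · have h : (fun a => constJet n a ⟨k + 1, hk⟩) = fun _ => 0 := by
      funext a
      simp only [constJet, iteratedFDeriv_const_of_ne (𝕜 := ℝ) (E := E4) k.succ_ne_zero a,
        Pi.zero_apply]
    rw [h]
    exact contDiff_const

theorem jetCoord_jet_of_eventuallyEq_const {n : ℕ} {e : OpenPartialHomeomorph M E4}
    (he : e ∈ Charts M) {p : M} (hp : p ∈ e.source) {R : RiemSection M} {a : TriArr}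
    (h : curvFieldComp e R.toFun =ᶠ[𝓝 (e p)] fun _ => a) :
    jetCoord n e (jet n p R) = (e p, constJet n a) := by
  rw [jetCoord_jet he hp]
  refine Prod.ext rfl (funext fun k => ?_)
  refine (h.iteratedFDeriv ℝ k).eq_of_nhds.trans ?_
  have := iteratedFDeriv_comp_add_right (𝕜 := ℝ) (f := fun _ : E4 => a) k (-e p) (e p)
  rw [add_neg_cancel] at this
  exact this

variable (M) in
/-- The zero cross-section. -/
noncomputable def RiemSection.zero : RiemSection M where
  toFun _ := 0
  smooth e _ := by
    have : curvFieldComp e (fun _ => 0 : ∀ q : M, Curv q) = fun _ => 0 := by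
      funext x i j k l
      simp [curvFieldComp, triComp]
    rw [this]
    exact contDiffOn_const

theorem iteratedFDeriv_zeroSection (e : OpenPartialHomeomorph M E4) (x : E4) (k : ℕ) :
    iteratedFDeriv ℝ k (curvFieldComp e (RiemSection.zero M).toFun) x = 0 := by
  have : curvFieldComp e (RiemSection.zero M).toFun = fun _ => 0 := by
    funext x i j k l
    simp [curvFieldComp, triComp, RiemSection.zero]
  rw [this]
  simp

/-- The target of the image of a jet is the image of the target of the jet. -/
theorem pushField_apply (φ : Diff M) (R : ∀ q : M, Curv q) (p : M) :
    pushField φ R (φ p) = curvTransport (diffEquiv φ p) (R p) := by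
  have hA : ∀ w : Tan (φ.symm (φ p)),
      (diffEquiv φ.symm (φ p)).symm w = mfderiv 𝓘(ℝ, E4) 𝓘(ℝ, E4) φ (φ.symm (φ p)) w := by
    intro w
    refine (LinearEquiv.symm_apply_eq _).2 ?_
    have h1 : MDifferentiableAt 𝓘(ℝ, E4) 𝓘(ℝ, E4) φ.symm (φ p) :=
      φ.symm.contMDiff.contMDiffAt.mdifferentiableAt (by simp)
    have h2 : MDifferentiableAt 𝓘(ℝ, E4) 𝓘(ℝ, E4) φ (φ.symm (φ p)) :=
      φ.contMDiff.contMDiffAt.mdifferentiableAt (by simp)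
    have h3 := mfderiv_comp_apply_of_eq (x := φ.symm (φ p)) h1 h2 (φ.apply_symm_apply _) w
    have h4 : φ.symm ∘ φ = id := funext φ.symm_apply_apply
    rw [h4, mfderiv_id] at h3
    exact h3
  have key : ∀ q, q = p → ∀ A : Tan q ≃ₗ[ℝ] Tan (φ p),
      (∀ w, A w = mfderiv 𝓘(ℝ, E4) 𝓘(ℝ, E4) φ q w) →
      curvTransport A (R q) = curvTransport (diffEquiv φ p) (R p) := by
    rintro q rfl A hA
    have : A = diffEquiv φ q := LinearEquiv.ext hA
    rw [this]
  exact key _ (φ.symm_apply_apply p) _ hA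

/-! ### Concomitants preserve base points -/

variable [IsManifold 𝓘(ℝ, E4) ∞ M] {n : ℕ} {χ : JetRiem M n → BCov M}

/-- The coordinates of a jet in a single chart determine the value of a smooth mapping. -/
theorem IsConcomitant.eq_of_jetCoord_eq (hχ : IsConcomitant χ) {e : OpenPartialHomeomorph M E4}
    (he : e ∈ Charts M) {u v : JetRiem M n} (hu : u.1 ∈ e.source) (hv : v.1 ∈ e.source)
    (h : jetCoord n e u = jetCoord n e v) : χ u = χ v := by
  have he' : chartAt E4 (χ u).1 ∈ Charts M := IsManifold.chart_mem_maximalAtlas _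
  obtain ⟨N, -, huN, F, -, hF⟩ := hχ.smooth e he _ he' u hu (mem_chart_source E4 _)
  obtain ⟨h1, h2⟩ := hF u hu huN
  obtain ⟨h3, h4⟩ := hF v hv (h ▸ huN)
  exact covCoord_injOn he' h1 h3 (by rw [h2, h4, h])

/-- Equivariance forces a concomitant to cover the identity: a diffeomorphism which is the identity
near the base point of a jet fixes the jet, hence fixes the base point of its image. -/
theorem IsConcomitant.fst_eq [T2Space M] (hχ : IsConcomitant χ) (u : JetRiem M n) :
    (χ u).1 = u.1 := by
  by_contra hne
  obtain ⟨φ, hφ, hφq⟩ := exists_diffeo_eventually_id_and_ne (Ne.symm hne)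
  obtain ⟨R, hR⟩ := exists_eq_jet u
  generalize u.1 = p at *
  subst hR
  have he : chartAt E4 p ∈ Charts M := IsManifold.chart_mem_maximalAtlas _
  have hp : p ∈ (chartAt E4 p).source := mem_chart_source E4 p
  have hd : IsDilationAt φ (chartAt E4 p) p 1 :=
    ⟨hφ.self_of_nhds, by filter_upwards [hφ] with y hy; simp [hy]⟩
  have h1 : jetInduction φ (jet n p R) = jet n (φ p) (R.push φ) := rfl
  rw [hd.fixed] at h1
  have h2 : χ (jet n p (R.push φ)) = χ (jet n p R) := by
    refine hχ.eq_of_jetCoord_eq he hp hp ?_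
    rw [jetCoord_jet he hp, jetCoord_jet he hp]
    refine Prod.ext rfl (funext fun k => ?_)
    simpa using iteratedFDeriv_push_of_isDilationAt hd he hp one_ne_zero R k
  have h3 := hχ.equivariant φ (jet n p R)
  rw [h1, h2] at h3
  exact hφq (congrArg Sigma.fst h3).symm

/-! ### Homogeneity under dilations -/

theorem IsConcomitant.covCoord_push (hχ : IsConcomitant χ) [T2Space M] {φ : Diff M}
    {e : OpenPartialHomeomorph M E4} {p : M} {μ : ℝ} (h : IsDilationAt φ e p μ)
    (he : e ∈ Charts M) (hp : p ∈ e.source) (hμ : μ ≠ 0) (R : RiemSection M) :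
    (covCoord e (χ (jet n p (R.push φ)))).2 = μ⁻¹ ^ 2 • (covCoord e (χ (jet n p R))).2 := by
  have h1 : jetInduction φ (jet n p R) = jet n (φ p) (R.push φ) := rfl
  rw [h.fixed] at h1
  rw [← h1, hχ.equivariant]
  exact covComp_covInduction_of_isDilationAt h he hp hμ (hχ.fst_eq _)

theorem IsConcomitant.covCoord_push_iterate (hχ : IsConcomitant χ) [T2Space M] {φ : Diff M}
    {e : OpenPartialHomeomorph M E4} {p : M} {μ : ℝ} (h : IsDilationAt φ e p μ)
    (he : e ∈ Charts M) (hp : p ∈ e.source) (hμ : μ ≠ 0) (R : RiemSection M) (m : ℕ) :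
    (covCoord e (χ (jet n p ((RiemSection.push φ)^[m] R)))).2 =
      (μ⁻¹ ^ 2) ^ m • (covCoord e (χ (jet n p R))).2 := by
  induction m with
  | zero => simp
  | succ m ih =>
    rw [Function.iterate_succ_apply', hχ.covCoord_push h he hp hμ, ih, smul_smul,
      pow_succ' (μ⁻¹ ^ 2)]

theorem iteratedFDeriv_push_iterate {φ : Diff M} {e : OpenPartialHomeomorph M E4} {p : M}
    {μ : ℝ} (h : IsDilationAt φ e p μ) (he : e ∈ Charts M) (hp : p ∈ e.source) (hμ : μ ≠ 0)
    (R : RiemSection M) (k m : ℕ) :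
    iteratedFDeriv ℝ k (curvFieldComp e ((RiemSection.push φ)^[m] R).toFun) (e p) =
      (μ⁻¹ ^ 2 * μ⁻¹ ^ k) ^ m • iteratedFDeriv ℝ k (curvFieldComp e R.toFun) (e p) := by
  induction m with
  | zero => simp
  | succ m ih =>
    rw [Function.iterate_succ_apply', iteratedFDeriv_push_of_isDilationAt h he hp hμ, ih,
      smul_smul, pow_succ' (μ⁻¹ ^ 2 * μ⁻¹ ^ k)]

/-- The components of a concomitant at `p` are a linear function of the components of the value at
`p` of the cross-section, namely the derivative at the zero jet of a coordinate expression. -/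
theorem IsConcomitant.exists_linear [T2Space M] (hχ : IsConcomitant χ)
    {e : OpenPartialHomeomorph M E4} (he : e ∈ Charts M) {p : M} (hp : p ∈ e.source) :
    ∃ L : JetCoord n →L[ℝ] E4 × CovArr, ∀ R : RiemSection M,
      (covCoord e (χ (jet n p R))).2 = (L (0, constJet n (triComp e p (R.toFun p).1))).2 := by
  obtain ⟨φ, μ, hμ, hφ, hφe⟩ := exists_diffeo_dilation he hp
  have hd : IsDilationAt φ e p μ := ⟨hφ, hφe⟩
  have hμ0 : μ ≠ 0 := by positivity
  set t := μ⁻¹ with ht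
  have ht0 : 0 < t := by positivity
  have ht1 : t < 1 := inv_lt_one_of_one_lt₀ hμ
  let z₀ : JetCoord n := (e p, 0)
  have hz₀ : jetCoord n e (jet n p (RiemSection.zero M)) = z₀ := by
    rw [jetCoord_jet he hp]
    exact Prod.ext rfl (funext fun k => iteratedFDeriv_zeroSection e (e p) k)
  -- The dilation fixes the zero jet and multiplies its image by `t ^ 2 ≠ 1`.
  have hs₀ : (covCoord e (χ (jet n p (RiemSection.zero M)))).2 = 0 := by
    have h1 := hχ.covCoord_push hd he hp hμ0 (RiemSection.zero M)
    have h2 : χ (jet n p ((RiemSection.zero M).push φ)) = χ (jet n p (RiemSection.zero M)) := by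
      refine hχ.eq_of_jetCoord_eq he hp hp ?_
      rw [hz₀, jetCoord_jet he hp]
      refine Prod.ext rfl (funext fun k => ?_)
      simp only [iteratedFDeriv_push_of_isDilationAt hd he hp hμ0, iteratedFDeriv_zeroSection,
        smul_zero]
      rfl
    rw [h2] at h1
    have h3 : (1 - t ^ 2) • (covCoord e (χ (jet n p (RiemSection.zero M)))).2 = 0 := by
      rw [sub_smul, one_smul, sub_eq_zero]
      exact h1
    refine (smul_eq_zero.1 h3).resolve_left ?_
    have : t ^ 2 < 1 := pow_lt_one₀ ht0.le ht1 two_ne_zero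
    linarith
  have hfst : ∀ R : RiemSection M, (χ (jet n p R)).1 ∈ e.source := fun R => by
    rw [hχ.fst_eq]
    exact hp
  obtain ⟨N, hN, hzN, F, hFs, hF⟩ := hχ.smooth e he e he (jet n p (RiemSection.zero M)) hp
    (hfst _)
  rw [hz₀] at hzN
  have hFd : HasFDerivAt F (fderiv ℝ F z₀) z₀ :=
    ((hFs.contDiffAt (hN.mem_nhds hzN)).differentiableAt (by simp)).hasFDerivAt
  refine ⟨fderiv ℝ F z₀, fun R => ?_⟩
  let D : (k : Fin (n + 1)) → E4 [×(k : ℕ)]→L[ℝ] TriArr :=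
    fun k => iteratedFDeriv ℝ k (curvFieldComp e R.toFun) (e p)
  -- The coordinates of the jet of the `m`-th push-forward differ by `d m` from those of the zero
  -- jet; the summand of order `k` of `d m` is of size `t ^ (m * (k + 2))`.
  let d : ℕ → JetCoord n := fun m => (0, fun k => (t ^ 2 * t ^ (k : ℕ)) ^ m • D k)
  have hjet : ∀ m, jetCoord n e (jet n p ((RiemSection.push φ)^[m] R)) = z₀ + d m := fun m => by
    rw [jetCoord_jet he hp]
    refine Prod.ext (by simp [z₀, d]) (funext fun k => ?_)
    simp only [z₀, d, Prod.mk_add_mk, zero_add]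
    exact iteratedFDeriv_push_iterate hd he hp hμ0 R k m
  have ht2 : t ^ 2 < 1 := pow_lt_one₀ ht0.le ht1 two_ne_zero
  have hd0 : Filter.Tendsto d Filter.atTop (𝓝 0) := by
    refine Filter.Tendsto.prodMk_nhds tendsto_const_nhds (tendsto_pi_nhds.2 fun k => ?_)
    have h1 : t ^ 2 * t ^ (k : ℕ) < 1 :=
      (mul_le_of_le_one_right (by positivity) (pow_le_one₀ ht0.le ht1.le)).trans_lt ht2
    simpa using (tendsto_pow_atTop_nhds_zero_of_lt_one (by positivity) h1).smul_const (D k)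
  -- After division by `t ^ (2 * m)` only the derivative of order `0` survives in the limit.
  have hcd : Filter.Tendsto (fun m => ((t ^ 2) ^ m)⁻¹ • d m) Filter.atTop
      (𝓝 (0, constJet n (triComp e p (R.toFun p).1))) := by
    have hcd' : ∀ m, ((t ^ 2) ^ m)⁻¹ • d m =
        ((0, fun k : Fin (n + 1) => (t ^ (k : ℕ)) ^ m • D k) : JetCoord n) := fun m => by
      refine Prod.ext (by simp [d]) (funext fun k => ?_)
      simp only [d, Prod.smul_mk, Pi.smul_apply, smul_smul, mul_pow]
      rw [inv_mul_cancel_left₀ (by positivity)]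
    simp_rw [hcd']
    refine Filter.Tendsto.prodMk_nhds tendsto_const_nhds (tendsto_pi_nhds.2 fun k => ?_)
    obtain ⟨k, hk⟩ := k
    rcases k with - | k
    · have h0 : constJet n (triComp e p (R.toFun p).1) ⟨0, hk⟩ = D ⟨0, hk⟩ := by
        simp only [constJet, D, iteratedFDeriv_zero_eq_comp, Function.comp_apply,
          curvFieldComp_apply_self hp]
      rw [h0]
      simp only [pow_zero, one_pow, one_smul]
      exact tendsto_const_nhds
    · have h0 : constJet n (triComp e p (R.toFun p).1) ⟨k + 1, hk⟩ = 0 := by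
        simp only [constJet, iteratedFDeriv_const_of_ne (𝕜 := ℝ) (E := E4) k.succ_ne_zero,
          Pi.zero_apply]
      rw [h0]
      have h1 : t ^ (k + 1) < 1 := pow_lt_one₀ ht0.le ht1 k.succ_ne_zero
      simpa using (tendsto_pow_atTop_nhds_zero_of_lt_one (by positivity) h1).smul_const
        (D ⟨k + 1, hk⟩)
  have hlim := hFd.hasFDerivWithinAt.lim (s := Set.univ) hd0
    (Filter.Eventually.of_forall fun _ => Set.mem_univ _) hcd
  have hlim2 := (continuous_snd.tendsto _).comp hlim
  have hev : ∀ᶠ m in Filter.atTop, z₀ + d m ∈ N := by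
    have h1 : Filter.Tendsto (fun m => z₀ + d m) Filter.atTop (𝓝 z₀) := by
      simpa using hd0.const_add z₀
    exact h1.eventually (hN.mem_nhds hzN)
  -- The difference quotients of `F` along `d` are constant, by homogeneity of weight `2`.
  have hconst : ∀ᶠ m in Filter.atTop, (covCoord e (χ (jet n p R))).2 =
      (((t ^ 2) ^ m)⁻¹ • (F (z₀ + d m) - F z₀)).2 := by
    filter_upwards [hev] with m hm
    have h1 := (hF (jet n p ((RiemSection.push φ)^[m] R)) hp (by rw [hjet]; exact hm)).2
    have h2 := (hF (jet n p (RiemSection.zero M)) hp (by rw [hz₀]; exact hzN)).2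
    rw [hjet] at h1
    rw [hz₀] at h2
    rw [← h1, ← h2, Prod.smul_snd, Prod.snd_sub, hs₀, sub_zero,
      hχ.covCoord_push_iterate hd he hp hμ0, inv_smul_smul₀ (by positivity)]
  exact tendsto_nhds_unique (tendsto_const_nhds.congr' hconst) hlim2

/-- The value of a concomitant on a jet depends only on the target of the jet. -/
theorem IsConcomitant.jet_eq_of_value_eq [T2Space M] (hχ : IsConcomitant χ) {p : M}
    {R S : RiemSection M} (h : R.toFun p = S.toFun p) : χ (jet n p R) = χ (jet n p S) := by
  have he : chartAt E4 p ∈ Charts M := IsManifold.chart_mem_maximalAtlas _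
  have hp : p ∈ (chartAt E4 p).source := mem_chart_source E4 p
  have hR := hχ.fst_eq (jet n p R)
  have hS := hχ.fst_eq (jet n p S)
  obtain ⟨L, hL⟩ := hχ.exists_linear he hp
  refine covCoord_injOn he (by rw [hR]; exact hp) (by rw [hS]; exact hp) (Prod.ext ?_ ?_)
  · change chartAt E4 p (χ (jet n p R)).1 = chartAt E4 p (χ (jet n p S)).1
    rw [hR, hS]
    rfl
  · rw [hL, hL, h]

/-! ### The induced zeroth-order concomitant -/

/-- A mapping from the bundle of curvature-type tensors which gives the values of a concomitant on
jets is a zeroth-order concomitant. -/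
theorem IsConcomitant.isZerothOrderConcomitant [T2Space M] (hχ : IsConcomitant χ)
    {χ₀ : BRiem M → BCov M}
    (h : ∀ (p : M) (R : RiemSection M), χ₀ ⟨p, R.toFun p⟩ = χ (jet n p R)) :
    IsZerothOrderConcomitant χ₀ where
  smooth := by
    intro e he e' he' u hu hu'
    have hsec : ∀ v : BRiem M, v.1 ∈ e.source → ∃ R : RiemSection M, χ₀ v = χ (jet n v.1 R) ∧
        jetCoord n e (jet n v.1 R) = ((riemCoord e v).1, constJet n (riemCoord e v).2) := by
      rintro ⟨p, T⟩ hp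
      change p ∈ e.source at hp
      obtain ⟨R, rfl, hR⟩ := exists_section_of_value he hp T
      exact ⟨R, h p R, jetCoord_jet_of_eventuallyEq_const he hp hR⟩
    obtain ⟨R, hR, hRc⟩ := hsec u hu
    rw [hR] at hu'
    obtain ⟨N, hN, huN, F, hFs, hF⟩ := hχ.smooth e he e' he' (jet n u.1 R) hu hu'
    -- The coordinate expression on jets is restricted to the jets of constant arrays.
    let J : E4 × TriArr → JetCoord n := fun z => (z.1, constJet n z.2)
    have hJ : ContDiff ℝ ∞ J := contDiff_fst.prodMk ((contDiff_constJet n).comp contDiff_snd)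
    refine ⟨J ⁻¹' N, hN.preimage hJ.continuous, ?_, F ∘ J,
      hFs.comp hJ.contDiffOn fun z hz => hz, fun v hv hvN => ?_⟩
    · rw [hRc] at huN
      exact huN
    · obtain ⟨S, hS, hSc⟩ := hsec v hv
      have := hF (jet n v.1 S) hv (by rw [hSc]; exact hvN)
      rw [hSc] at this
      rw [hS]
      exact this
  equivariant := by
    rintro φ ⟨p, T⟩
    obtain ⟨R, rfl, -⟩ := exists_section_of_value (IsManifold.chart_mem_maximalAtlas p)
      (mem_chart_source E4 p) T
    have h1 : riemInduction φ ⟨p, R.toFun p⟩ = ⟨φ p, (R.push φ).toFun (φ p)⟩ :=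
      congrArg (Sigma.mk (φ p)) (pushField_apply φ R.toFun p).symm
    rw [h1, h, h, ← hχ.equivariant]
    rfl

/-- Each concomitant of the Riemann tensor with two covariant indices is of order zero. -/
theorem IsConcomitant.isOfOrderZero [T2Space M] (hχ : IsConcomitant χ) : IsOfOrderZero χ := by
  have hsec : ∀ u : BRiem M, ∃ R : RiemSection M, R.toFun u.1 = u.2 := fun u => by
    obtain ⟨R, hR, -⟩ := exists_section_of_value (IsManifold.chart_mem_maximalAtlas u.1)
      (mem_chart_source E4 u.1) u.2
    exact ⟨R, hR⟩
  choose s hs using hsec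
  -- The choice of the cross-section through a given value does not matter.
  let χ₀ : BRiem M → BCov M := fun u => χ (jet n u.1 (s u))
  have h : ∀ (p : M) (R : RiemSection M), χ₀ ⟨p, R.toFun p⟩ = χ (jet n p R) := fun p R =>
    hχ.jet_eq_of_value_eq (hs ⟨p, R.toFun p⟩)
  refine ⟨χ₀, hχ.isZerothOrderConcomitant h, fun u => ?_⟩
  obtain ⟨R, hR⟩ := exists_eq_jet u
  rw [hR]
  exact (h u.1 R).symm

end

/-! ### Constant rescaling of a metric -/

section

theorem pd_const_mul (i : Fin 4) (c : ℝ) (f : E4 → ℝ) (x : E4) :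
    pd i (fun y => c * f y) x = c * pd i f x := by
  have : (fun y => c * f y) = c • f := rfl
  unfold pd
  rw [this, fderiv_const_smul_field]
  rfl

theorem matrix_inv_smul (A : Matrix (Fin 4) (Fin 4) ℝ) {c : ℝ} (hc : c ≠ 0) :
    (c • A)⁻¹ = c⁻¹ • A⁻¹ := by
  by_cases hA : IsUnit A.det
  · let _ := invertibleOfNonzero hc
    rw [Matrix.inv_smul A c hA, invOf_eq_inv]
  -- Both inverses are zero when `A` is singular.
  · have hA' : ¬IsUnit (c • A).det := by
      rw [Matrix.det_smul]
      exact fun h => hA (isUnit_of_mul_isUnit_right h)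
    rw [Matrix.nonsing_inv_apply_not_isUnit _ hA, Matrix.nonsing_inv_apply_not_isUnit _ hA',
      smul_zero]

/-- The Christoffel symbols do not change when the metric is multiplied by a constant. -/
theorem christoffel_smul (G : E4 → CovArr) {c : ℝ} (hc : c ≠ 0) :
    christoffel (fun x => c • G x) = christoffel G := by
  funext l j k x
  have h : Matrix.of (c • G x) = c • Matrix.of (G x) := rfl
  simp only [christoffel, h, matrix_inv_smul _ hc, Pi.smul_apply, Matrix.smul_apply, smul_eq_mul,
    pd_const_mul]
  congr 1
  refine Finset.sum_congr rfl fun m _ => ?_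
  field_simp

variable {M : Type*} [TopologicalSpace M] [ChartedSpace E4 M]

theorem riemannTensor_smul (g : ∀ q : M, Cov q) {c : ℝ} (hc : c ≠ 0) (q : M) :
    riemannTensor (fun q => c • g q) q = riemannTensor g q := by
  have h : ∀ e : OpenPartialHomeomorph M E4,
      covFieldComp e (fun q => c • g q) = fun x => c • covFieldComp e g x := fun e => rfl
  simp only [riemannTensor, riemannArr, h, christoffel_smul _ hc]

/-- A mapping on jets of order zero is homogeneous of weight `0`, since the Riemann tensor does not
change when the metric is multiplied by a constant. -/
theorem IsOfOrderZero.isHomogeneousInMetric {n : ℕ} {χ : JetRiem M n → BCov M}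
    (h : IsOfOrderZero χ) : IsHomogeneousInMetric χ 0 := by
  obtain ⟨χ₀, -, hχ₀⟩ := h
  intro U g _ ξ hξ p _ R R' hR hR'
  have h1 : R'.toFun p = R.toFun p := Subtype.ext <| by
    rw [hR.self_of_nhds, hR'.self_of_nhds, riemannTensor_smul g hξ.ne']
  have h2 : ∀ S : RiemSection M, (jet n p S).target = ⟨p, S.toFun p⟩ := fun S => rfl
  rw [hχ₀, hχ₀, h2, h2, h1, Real.rpow_zero, BCov.scale, one_smul]

end

end Concom

theorem mainTheorem6 (M : Type*) [TopologicalSpace M] [ChartedSpace E4 M]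
    [IsManifold (modelWithCornersSelf ℝ E4) ∞ M] [T2Space M] [ParacompactSpace M]
    [ConnectedSpace M] (n : ℕ) (χ : JetRiem M n → BCov M) (hχ : IsConcomitant χ) :
    IsHomogeneousInMetric χ 0 ↔ IsOfOrderZero χ :=
  ⟨fun _ => hχ.isOfOrderZero, fun h => h.isHomogeneousInMetric⟩
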